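/- Let $d,k\in\mathbb N$, let $\mathcal D$ be a set of designs, and let $G:\mathbb R^d\times\mathcal D\to\mathbb R^k$ be linear in the parameter, $G(u,p)=A(p)u$ with $A(p)\in\mathbb R^{k\times d}$. Let $y=G(u,p)+\eta$ with prior $u\sim\mu_0=\mathcal N(m_0,\Sigma_0)$ and independent noise $\eta\sim\mathcal N(0,\Gamma)$, where $\Sigma_0\in\mathbb R^{d\times d}$ and $\Gamma\in\mathbb R^{k\times k}$ are symmetric positive definite. Fix $p\in\mathcal D$. Denote by $\mu_{u,y|p}$ the joint law of $(u,y)$, by $\mu_{y|p}$ the law of $y$, and by $\mu_{u|y,p}$ the posterior, i.e. the probability measure with density proportional to $\exp\left(-\tfrac12\langle y-A(p)u,\Gamma^{-1}(y-A(p)u)\rangle\right)$ with respect to $\mu_0$. Let $(u^{(j)},y^{(j)})_{j\ge1}$ be i.i.d. with law $\mu_{u,y|p}$. For $J\ge1$ let $\widetilde m_u=\frac1J\sum_{j\le J}u^{(j)}$, $\widetilde m_y=\frac1J\sum_{j\le J}y^{(j)}$ be the empirical means and $\widetilde C_{ab}=\frac1J\sum_{j\le J}(a^{(j)}-\widetilde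 m_a)(b^{(j)}-\widetilde m_b)^\top$, $a,b\in\{u,y\}$, the empirical covariances ($\widetilde C_a:=\widetilde C_{aa}$). Set $$\tilde\mu^{(J)}_{y|p}=\mathcal N(\widetilde m_y,\widetilde C_y),\qquad \tilde\mu^{(J)}_{u|y,p}=\mathcal N\left(\widetilde m_u+\widetilde C_{uy}\widetilde C_y^{-1}(y-\widetilde m_y),\ \widetilde C_u-\widetilde C_{uy}\widetilde C_y^{-1}\widetilde C_{uy}^\top\right).$$ (For all sufficiently large $J$ the empirical covariances involved are almost surely positive definite.) Then, with $L^2$ norms taken over the samples, as $J\to\infty$: 1. $\left\|D_{\mathrm{KL}}\left(\mu_{y|p}\,\|\,\tilde\mu^{(J)}_{y|p}\right)\right\|_{L^2}=\mathcal O(J^{-1})$; in particular this divergence tends to $0$ in $L^2$. 2. For every fixed $y\in\mathbb R^k$, $\left\|D_{\mathrm{KL}}\left(\mu_{u|y,p}\,\|\,\tilde\mu^{(J)}_{u|y,p}\right)\right\|_{L^2}=\mathcal O(J^{-1})$; in particular this divergence tends to $0$ in $L^2$. 3. Let $\mathrm{EIG}(p)=\mathbb E_{y|p}\left[D_{\mathrm{KL}}(\mu_{u|y,p}\,\|\,\mu_0)\right]$,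 which is finite, and, writing $\pi$ and $\tilde\pi$ for Lebesgue densities and taking expectations over $(u,y)\sim\mu_{u,y|p}$ with the samples held fixed, $$U_J=\mathbb E_{u,y|p}\left[\log\frac{\pi_{y|u,p}(y)}{\tilde\pi^{(J)}_{y|p}(y)}\right],\qquad L_J=\mathbb E_{u,y|p}\left[\log\frac{\tilde\pi^{(J)}_{u|y,p}(u)}{\pi_0(u)}\right].$$ For all sufficiently large $J$, almost surely both integrands are integrable and $L_J\le\mathrm{EIG}(p)\le U_J$. The bounds become tight: $\|U_J-\mathrm{EIG}(p)\|_{L^2}=\mathcal O(J^{-1})$ and $\|\mathrm{EIG}(p)-L_J\|_{L^2}=\mathcal O(J^{-1})$, so both differences tend to $0$ in $L^2$. -/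

import Mathlib

open MeasureTheory ProbabilityTheory InformationTheory Filter Topology Asymptotics
open scoped ENNReal Matrix

namespace BOED

noncomputable section

/-- The quadratic form `⟨x, S⁻¹ x⟩` (the square of the `S`-rescaled norm of `x`). -/
def quadInv {n : ℕ} (S : Matrix (Fin n) (Fin n) ℝ) (x : EuclideanSpace ℝ (Fin n)) : ℝ :=
  x.ofLp ⬝ᵥ (S⁻¹ *ᵥ x.ofLp)

/-- The Lebesgue density at `x` of the Gaussian law `N(m, S)` on `ℝⁿ`, for `S` positive definite. -/
def gaussianDensity {n : ℕ} (m : EuclideanSpace ℝ (Fin n)) (S : Matrix (Fin n) (Fin n) ℝ)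
    (x : EuclideanSpace ℝ (Fin n)) : ℝ :=
  (Real.sqrt ((2 * Real.pi) ^ n * S.det))⁻¹ * Real.exp (-(1 / 2) * quadInv S (x - m))

section Model

/-! The model `y = g(u) + η` at a fixed design, with prior `u ~ N(m₀, S₀)` and independent noise
`η ~ N(0, Γ)`. -/

variable {d k : ℕ}

/-- The joint law of `(u, y)`. -/
def jointLaw (m₀ : EuclideanSpace ℝ (Fin d)) (S₀ : Matrix (Fin d) (Fin d) ℝ)
    (Γ : Matrix (Fin k) (Fin k) ℝ) (g : EuclideanSpace ℝ (Fin d) → EuclideanSpace ℝ (Fin k)) :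
    Measure (EuclideanSpace ℝ (Fin d) × EuclideanSpace ℝ (Fin k)) :=
  ((multivariateGaussian m₀ S₀).prod (multivariateGaussian 0 Γ)).map
    (fun z ↦ (z.1, g z.1 + z.2))

/-- The law of the data `y`. -/
def marginalLaw (m₀ : EuclideanSpace ℝ (Fin d)) (S₀ : Matrix (Fin d) (Fin d) ℝ)
    (Γ : Matrix (Fin k) (Fin k) ℝ) (g : EuclideanSpace ℝ (Fin d) → EuclideanSpace ℝ (Fin k)) :
    Measure (EuclideanSpace ℝ (Fin k)) :=
  (jointLaw m₀ S₀ Γ g).snd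

/-- The posterior of `u` given the data `y`: the probability measure whose density with respect
to the prior is proportional to `exp (-½ ⟨y - g(u), Γ⁻¹ (y - g(u))⟩)`. -/
def posteriorLaw (m₀ : EuclideanSpace ℝ (Fin d)) (S₀ : Matrix (Fin d) (Fin d) ℝ)
    (Γ : Matrix (Fin k) (Fin k) ℝ) (g : EuclideanSpace ℝ (Fin d) → EuclideanSpace ℝ (Fin k))
    (y : EuclideanSpace ℝ (Fin k)) : Measure (EuclideanSpace ℝ (Fin d)) :=
  (multivariateGaussian m₀ S₀).tilted (fun u ↦ -((1 / 2) * quadInv Γ (y - g u)))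

/-- The expected information gain: the mean over `y` of the Kullback-Leibler divergence of the
posterior from the prior. -/
def EIG (m₀ : EuclideanSpace ℝ (Fin d)) (S₀ : Matrix (Fin d) (Fin d) ℝ)
    (Γ : Matrix (Fin k) (Fin k) ℝ) (g : EuclideanSpace ℝ (Fin d) → EuclideanSpace ℝ (Fin k)) :
    ℝ≥0∞ :=
  ∫⁻ y, klDiv (posteriorLaw m₀ S₀ Γ g y) (multivariateGaussian m₀ S₀) ∂(marginalLaw m₀ S₀ Γ g)

end Model

section Empirical

/-- The empirical mean of the first `J` sample points. -/
def empMean {n : ℕ} (x : ℕ → EuclideanSpace ℝ (Fin n)) (J : ℕ) : EuclideanSpace ℝ (Fin n) :=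
  (J : ℝ)⁻¹ • ∑ j ∈ Finset.range J, x j

/-- The empirical cross covariance, normalized by `1 / J`, of the first `J` sample points. -/
def empCov {a b : ℕ} (x : ℕ → EuclideanSpace ℝ (Fin a)) (z : ℕ → EuclideanSpace ℝ (Fin b))
    (J : ℕ) : Matrix (Fin a) (Fin b) ℝ :=
  (J : ℝ)⁻¹ • ∑ j ∈ Finset.range J,
    Matrix.vecMulVec (x j - empMean x J).ofLp (z j - empMean z J).ofLp

variable {d k : ℕ} (u : ℕ → EuclideanSpace ℝ (Fin d)) (y : ℕ → EuclideanSpace ℝ (Fin k)) (J : ℕ)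

/-- The empirical Gaussian approximation of the law of the data. -/
def approxMarginal : Measure (EuclideanSpace ℝ (Fin k)) :=
  multivariateGaussian (empMean y J) (empCov y y J)

/-- The empirical (Kalman) conditional mean of `u` given the data value `y₀`. -/
def approxPostMean (y₀ : EuclideanSpace ℝ (Fin k)) : EuclideanSpace ℝ (Fin d) :=
  empMean u J +
    WithLp.toLp 2 ((empCov u y J * (empCov y y J)⁻¹) *ᵥ (y₀ - empMean y J).ofLp)

/-- The empirical (Kalman) conditional covariance of `u` given the data. -/
def approxPostCov : Matrix (Fin d) (Fin d) ℝ :=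
  empCov u u J - empCov u y J * (empCov y y J)⁻¹ * (empCov u y J)ᵀ

/-- The empirical Gaussian approximation of the posterior given the data value `y₀`. -/
def approxPosterior (y₀ : EuclideanSpace ℝ (Fin k)) : Measure (EuclideanSpace ℝ (Fin d)) :=
  multivariateGaussian (approxPostMean u y J y₀) (approxPostCov u y J)

/-- The integrand `log (π(y | u) / π̃(y))` of the upper bound, at `z = (u, y)`. -/
def upperIntegrand (Γ : Matrix (Fin k) (Fin k) ℝ)
    (g : EuclideanSpace ℝ (Fin d) → EuclideanSpace ℝ (Fin k))
    (z : EuclideanSpace ℝ (Fin d) × EuclideanSpace ℝ (Fin k)) : ℝ :=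
  Real.log (gaussianDensity (g z.1) Γ z.2 / gaussianDensity (empMean y J) (empCov y y J) z.2)

/-- The integrand `log (π̃(u | y) / π₀(u))` of the lower bound, at `z = (u, y)`. -/
def lowerIntegrand (m₀ : EuclideanSpace ℝ (Fin d)) (S₀ : Matrix (Fin d) (Fin d) ℝ)
    (z : EuclideanSpace ℝ (Fin d) × EuclideanSpace ℝ (Fin k)) : ℝ :=
  Real.log (gaussianDensity (approxPostMean u y J z.2) (approxPostCov u y J) z.1 /
    gaussianDensity m₀ S₀ z.1)

/-- The upper bound on the EIG: the mean of `log (π(y | u) / π̃(y))` over the joint law. -/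
def eigUpper (m₀ : EuclideanSpace ℝ (Fin d)) (S₀ : Matrix (Fin d) (Fin d) ℝ)
    (Γ : Matrix (Fin k) (Fin k) ℝ)
    (g : EuclideanSpace ℝ (Fin d) → EuclideanSpace ℝ (Fin k)) : ℝ :=
  ∫ z, upperIntegrand y J Γ g z ∂(jointLaw m₀ S₀ Γ g)

/-- The lower bound on the EIG: the mean of `log (π̃(u | y) / π₀(u))` over the joint law. -/
def eigLower (m₀ : EuclideanSpace ℝ (Fin d)) (S₀ : Matrix (Fin d) (Fin d) ℝ)
    (Γ : Matrix (Fin k) (Fin k) ℝ)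
    (g : EuclideanSpace ℝ (Fin d) → EuclideanSpace ℝ (Fin k)) : ℝ :=
  ∫ z, lowerIntegrand u y J m₀ S₀ z ∂(jointLaw m₀ S₀ Γ g)

end Empirical

/-- The random variables `X J` tend to `0` in `L²(P)` as `J → ∞` and their `L²` norms are
`O(r J)`. (The first clause also says that `X J` is measurable up to a null set and square
integrable for all large `J`.) -/
def TendstoZeroL2WithRate {Ω : Type*} [MeasurableSpace Ω] (P : Measure Ω) {E : Type*}
    [TopologicalSpace E] [ENorm E] (X : ℕ → Ω → E) (r : ℕ → ℝ) : Prop :=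
  (∀ᶠ J in atTop, MemLp (X J) 2 P) ∧
    Tendsto (fun J ↦ eLpNorm (X J) 2 P) atTop (𝓝 0) ∧
    (fun J ↦ (eLpNorm (X J) 2 P).toReal) =O[atTop] r

end

end BOED

/-! In the linear Gaussian model all laws involved are Gaussian, so every quantity in the theorem is
an explicit function of means and covariances. With `gaussKL` for the Gaussian divergence, the gap
of the upper bound is the divergence of the data law from its approximation (`upper_bound_eq`). The
gap of the lower bound is the divergence of the posteriors at the data value `A m₀` plus a trace
quadratic in the error of the Kalman gain (`lower_bound_eq`). Everything then reduces to one claim: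
the divergence between a fixed Gaussian and its empirical version is `O(1/J)` in `L²`.

The divergence is quadratic in the errors. Adding the nonnegative divergence in the reverse
direction cancels the log-determinants and leaves a trace containing the covariance error twice
(`gaussKL_le`). The errors are of order `J ^ (-1/2)` in every `Lᵠ`, because the moments of order
`2m` of a sum of `J` independent centred variables grow at most like `J ^ m`
(`exists_integral_sum_pow_le`, `hasRate_average`). Having all `q` makes the rates multiplicative
under Hölder's inequality, so they pass to products, traces and Schur complements.

The delicate point is the inverse of an empirical covariance, whose determinant can be arbitrarily
small. By Cramer's rule it suffices to bound the moments of `1 / det`. The Gaussian integral of `exp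
(-½ ⟨v, S v⟩)` is `√((2π)ⁿ / det S)`, so these are moments of an integral over `v` (`gaussInt`). A
weighted Hölder inequality moves the power inside, Tonelli's theorem exchanges the integrals, and
for fixed `v` one needs the exponential moment of a scalar empirical variance. Comparing with
increments over disjoint pairs of samples removes the empirical mean and gives an explicit product
(`integral_exp_neg_sum_sq_le`). The resulting bounds hold once `J` is large depending on the order
`q`, hence the order of quantifiers in `HasRate`. Finiteness of the integral also gives almost sure
positive definiteness (`posDef_covMat_and_hasRate_inv_det`). -/

namespace BOED

/-! ### Sequences of random variables with a rate in every `Lᵠ` -/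

section Rate

open scoped NNReal

variable {Ω : Type*} [MeasurableSpace Ω] {P : Measure Ω}

/-- For every finite `q`, the `Lᵠ` norm of `X J` is `O(J ^ (-e / 2))` as `J → ∞`. -/
def HasRate (P : Measure Ω) (e : ℕ) (X : ℕ → Ω → ℝ) : Prop :=
  ∀ q : ℕ, q ≠ 0 → ∃ c : ℝ≥0, ∀ᶠ J : ℕ in atTop,
    AEStronglyMeasurable (X J) P ∧
      eLpNorm (X J) q P ≤ c * (ENNReal.ofReal (√(J : ℝ))⁻¹) ^ e

lemma HasRate.aestronglyMeasurable {e : ℕ} {X : ℕ → Ω → ℝ} (hX : HasRate P e X) :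
    ∀ᶠ J in atTop, AEStronglyMeasurable (X J) P := by
  obtain ⟨c, hc⟩ := hX 1 one_ne_zero
  exact hc.mono fun J h ↦ h.1

lemma HasRate.of_abs_le {e : ℕ} {X Y : ℕ → Ω → ℝ} (hY : HasRate P e Y)
    (hX : ∀ᶠ J in atTop, AEStronglyMeasurable (X J) P)
    (h : ∀ᶠ J in atTop, ∀ᵐ ω ∂P, |X J ω| ≤ |Y J ω|) : HasRate P e X := by
  intro q hq
  obtain ⟨c, hc⟩ := hY q hq
  refine ⟨c, ?_⟩
  filter_upwards [hc, hX, h] with J h1 h2 h3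
  exact ⟨h2, (eLpNorm_mono_ae h3).trans h1.2⟩

lemma HasRate.congr {e : ℕ} {X Y : ℕ → Ω → ℝ} (hX : HasRate P e X)
    (h : ∀ᶠ J in atTop, X J =ᵐ[P] Y J) : HasRate P e Y := by
  intro q hq
  obtain ⟨c, hc⟩ := hX q hq
  refine ⟨c, ?_⟩
  filter_upwards [hc, h] with J h1 h2
  exact ⟨h1.1.congr h2, (eLpNorm_congr_ae h2).symm.le.trans h1.2⟩

lemma HasRate.mono {e e' : ℕ} {X : ℕ → Ω → ℝ} (hX : HasRate P e X) (h : e' ≤ e) :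
    HasRate P e' X := by
  intro q hq
  obtain ⟨c, hc⟩ := hX q hq
  refine ⟨c, ?_⟩
  filter_upwards [hc, eventually_ge_atTop 1] with J h1 hJ
  refine ⟨h1.1, h1.2.trans ?_⟩
  gcongr 1
  refine pow_le_pow_right_of_le_one' ?_ h
  have : (1 : ℝ) ≤ √(J : ℝ) := Real.one_le_sqrt.2 (by exact_mod_cast hJ)
  exact ENNReal.ofReal_le_one.2 (inv_le_one_of_one_le₀ this)

lemma HasRate.zero {e : ℕ} : HasRate P e (fun _ _ ↦ 0) := by
  intro q hq
  refine ⟨0, Eventually.of_forall fun J ↦ ⟨aestronglyMeasurable_const, ?_⟩⟩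
  simp

lemma HasRate.const [IsProbabilityMeasure P] (a : ℝ) : HasRate P 0 (fun _ _ ↦ a) := by
  intro q hq
  refine ⟨‖a‖₊, Eventually.of_forall fun J ↦ ⟨aestronglyMeasurable_const, ?_⟩⟩
  rw [eLpNorm_const _ (by exact_mod_cast hq) (IsProbabilityMeasure.ne_zero P)]
  simp [enorm_eq_nnnorm]

lemma HasRate.add {e : ℕ} {X Y : ℕ → Ω → ℝ} (hX : HasRate P e X) (hY : HasRate P e Y) :
    HasRate P e (fun J ω ↦ X J ω + Y J ω) := by
  intro q hq
  obtain ⟨c, hc⟩ := hX q hq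
  obtain ⟨c', hc'⟩ := hY q hq
  refine ⟨c + c', ?_⟩
  filter_upwards [hc, hc'] with J h1 h2
  refine ⟨h1.1.add h2.1, (eLpNorm_add_le h1.1 h2.1 ?_).trans ?_⟩
  · exact_mod_cast Nat.one_le_iff_ne_zero.2 hq
  · push_cast
    rw [add_mul]
    exact add_le_add h1.2 h2.2

lemma HasRate.neg {e : ℕ} {X : ℕ → Ω → ℝ} (hX : HasRate P e X) :
    HasRate P e (fun J ω ↦ -X J ω) :=
  hX.of_abs_le (hX.aestronglyMeasurable.mono fun _ h ↦ h.neg)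
    (Eventually.of_forall fun _ ↦ Eventually.of_forall fun _ ↦ (abs_neg _).le)

lemma HasRate.sub {e : ℕ} {X Y : ℕ → Ω → ℝ} (hX : HasRate P e X) (hY : HasRate P e Y) :
    HasRate P e (fun J ω ↦ X J ω - Y J ω) := by
  simpa only [sub_eq_add_neg] using hX.add hY.neg

lemma HasRate.sum {ι : Type*} (s : Finset ι) {e : ℕ} {X : ι → ℕ → Ω → ℝ}
    (hX : ∀ i ∈ s, HasRate P e (X i)) : HasRate P e (fun J ω ↦ ∑ i ∈ s, X i J ω) := by
  classical
  induction s using Finset.induction_on with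
  | empty => simpa using HasRate.zero
  | insert a s ha ih =>
    simp only [Finset.sum_insert ha]
    exact (hX a (by simp)).add (ih fun i hi ↦ hX i (by simp [hi]))

/-- Hölder's inequality with exponents `2q`, `2q`, `q`. Each product doubles the order of the norms
needed, which is why `HasRate` asks for every `q`. -/
lemma HasRate.mul {e e' : ℕ} {X Y : ℕ → Ω → ℝ} (hX : HasRate P e X) (hY : HasRate P e' Y) :
    HasRate P (e + e') (fun J ω ↦ X J ω * Y J ω) := by
  intro q hq
  obtain ⟨c, hc⟩ := hX (2 * q) (by simpa using hq)
  obtain ⟨c', hc'⟩ := hY (2 * q) (by simpa using hq)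
  refine ⟨c * c', ?_⟩
  have : ENNReal.HolderTriple ((2 * q : ℕ) : ℝ≥0∞) ((2 * q : ℕ) : ℝ≥0∞) (q : ℝ≥0∞) := by
    constructor
    push_cast
    rw [ENNReal.mul_inv (by simp) (by simp), ← add_mul, ENNReal.inv_two_add_inv_two, one_mul]
  filter_upwards [hc, hc'] with J h1 h2
  refine ⟨h1.1.mul h2.1, (eLpNorm_smul_le_mul_eLpNorm (p := ((2 * q : ℕ) : ℝ≥0∞))
    (q := ((2 * q : ℕ) : ℝ≥0∞)) h2.1 h1.1).trans ((mul_le_mul' h1.2 h2.2).trans ?_)⟩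
  push_cast
  rw [pow_add]
  exact le_of_eq (by ring)

lemma HasRate.const_mul [IsProbabilityMeasure P] {e : ℕ} {X : ℕ → Ω → ℝ} (hX : HasRate P e X)
    (a : ℝ) : HasRate P e (fun J ω ↦ a * X J ω) := by
  simpa using (HasRate.const (P := P) a).mul hX

lemma HasRate.prod [IsProbabilityMeasure P] {ι : Type*} (s : Finset ι) {X : ι → ℕ → Ω → ℝ}
    (hX : ∀ i ∈ s, HasRate P 0 (X i)) : HasRate P 0 (fun J ω ↦ ∏ i ∈ s, X i J ω) := by
  classical
  induction s using Finset.induction_on with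
  | empty => simpa using HasRate.const (P := P) 1
  | insert a s ha ih =>
    simp only [Finset.prod_insert ha]
    exact (hX a (by simp)).mul (ih fun i hi ↦ hX i (by simp [hi]))

end Rate

/-! ### Averages of independent centred random variables -/

section Average

open scoped NNReal

variable {Ω : Type*} [MeasurableSpace Ω] {P : Measure Ω} [IsProbabilityMeasure P]

/-- Lets one even moment, known from an induction hypothesis, control all moments of lower order. -/
lemma abs_pow_le_one_add_pow {k m : ℕ} (hk : k ≤ 2 * m) (s : ℝ) : |s ^ k| ≤ 1 + s ^ (2 * m) := by
  have h0 : 0 ≤ s ^ (2 * m) := by rw [pow_mul]; positivity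
  rw [abs_pow]
  rcases le_total |s| 1 with h | h
  · linarith [pow_le_one₀ (n := k) (abs_nonneg s) h]
  · have := pow_le_pow_right₀ h hk
    rw [(even_two_mul m).pow_abs] at this
    linarith

lemma integrable_pow_of_memLp {X : Ω → ℝ} (h : ∀ q : ℕ, MemLp X q P) (k : ℕ) :
    Integrable (fun ω ↦ X ω ^ k) P := by
  rcases eq_or_ne k 0 with rfl | hk
  · simp
  · refine ((h k).integrable_norm_pow hk).mono' ((h k).1.pow k) (Eventually.of_forall fun ω ↦ ?_)
    rw [norm_pow]

/-- The even moments of a sum of `J` independent centred variables grow like `J ^ m`. -/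
lemma exists_integral_sum_pow_le {ξ : ℕ → Ω → ℝ} (hindep : iIndepFun ξ P)
    (hmem : ∀ j (q : ℕ), MemLp (ξ j) q P) (hmean : ∀ j, ∫ ω, ξ j ω ∂P = 0)
    (hbdd : ∀ q : ℕ, ∃ M, ∀ j, |∫ ω, ξ j ω ^ q ∂P| ≤ M) (m : ℕ) :
    ∃ c : ℝ, 0 ≤ c ∧
      ∀ J : ℕ, ∫ ω, (∑ j ∈ Finset.range J, ξ j ω) ^ (2 * m) ∂P ≤ c * (J : ℝ) ^ m := by
  choose M hM using hbdd
  have hM0 : ∀ q, 0 ≤ M q := fun q ↦ (abs_nonneg _).trans (hM q 0)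
  have hSmem : ∀ (J q : ℕ), MemLp (fun ω ↦ ∑ j ∈ Finset.range J, ξ j ω) q P := fun J q ↦
    memLp_finsetSum _ fun j _ ↦ hmem j q
  have hind : ∀ J, IndepFun (fun ω ↦ ∑ j ∈ Finset.range J, ξ j ω) (ξ J) P := fun J ↦ by
    have := hindep.indepFun_sum_range_succ₀ (fun i ↦ (hmem i 1).1.aemeasurable) J
    rwa [show (∑ j ∈ Finset.range J, ξ j) = fun ω ↦ ∑ j ∈ Finset.range J, ξ j ω from by
      ext ω; simp] at this
  induction m with
  | zero => exact ⟨1, zero_le_one, fun J ↦ by simp⟩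
  | succ m ih =>
    obtain ⟨c, hc0, hc⟩ := ih
    set n := 2 * (m + 1) with hn
    -- In the binomial expansion of `(S + ξ J) ^ n`, the term `S ^ n` is handled by induction on
    -- `J`, and the term with `S ^ (n - 1)` has the factor `E[ξ J] = 0`. The others contain `S` to a
    -- power at most `2 * m`, so by induction on `m` they are at most a constant times `(J + 1) ^
    -- m`. `K` is the sum of these constants.
    set K := ∑ k ∈ Finset.range (2 * m + 1), (1 + c) * M (n - k) * (n.choose k : ℝ) with hK
    have hK0 : 0 ≤ K := Finset.sum_nonneg fun k _ ↦
      mul_nonneg (mul_nonneg (by linarith) (hM0 _)) (Nat.cast_nonneg _)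
    refine ⟨K, hK0, fun J ↦ ?_⟩
    induction J with
    | zero => simp [hn]
    | succ J ihJ =>
      set S : Ω → ℝ := fun ω ↦ ∑ j ∈ Finset.range J, ξ j ω with hS
      have hmul : ∀ a b : ℕ, ∫ ω, S ω ^ a * ξ J ω ^ b ∂P =
          (∫ ω, S ω ^ a ∂P) * ∫ ω, ξ J ω ^ b ∂P := fun a b ↦ by
        refine IndepFun.integral_fun_mul_eq_mul_integral (X := fun ω ↦ S ω ^ a)
          (Y := fun ω ↦ ξ J ω ^ b) ?_ ((hSmem J 1).1.pow a) ((hmem J 1).1.pow b)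
        exact (hind J).comp (measurable_id.pow_const a) (measurable_id.pow_const b)
      have h_int : ∀ a b : ℕ, Integrable (fun ω ↦ S ω ^ a * ξ J ω ^ b) P := fun a b ↦ by
        have : IndepFun (fun ω ↦ S ω ^ a) (fun ω ↦ ξ J ω ^ b) P :=
          (hind J).comp (measurable_id.pow_const a) (measurable_id.pow_const b)
        exact this.integrable_mul (integrable_pow_of_memLp (hSmem J) a)
          (integrable_pow_of_memLp (hmem J) b)
      have hexp : ∫ ω, (∑ j ∈ Finset.range (J + 1), ξ j ω) ^ n ∂P =
          ∑ k ∈ Finset.range (n + 1),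
            (∫ ω, S ω ^ k ∂P) * (∫ ω, ξ J ω ^ (n - k) ∂P) * (n.choose k : ℝ) := by
        simp_rw [Finset.sum_range_succ (fun j ↦ ξ j _) J, add_pow]
        rw [integral_finsetSum _ fun k _ ↦ (h_int k (n - k)).mul_const _]
        simp_rw [integral_mul_const]
        exact Finset.sum_congr rfl fun k _ ↦ by rw [hmul]
      have hlow : ∀ k ∈ Finset.range (2 * m + 1),
          (∫ ω, S ω ^ k ∂P) * (∫ ω, ξ J ω ^ (n - k) ∂P) * (n.choose k : ℝ) ≤
            (1 + c) * M (n - k) * (n.choose k : ℝ) * ((J : ℝ) + 1) ^ m := fun k hk ↦ by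
        have hk' : k ≤ 2 * m := by simpa [Nat.lt_succ_iff] using hk
        have h1 : |∫ ω, S ω ^ k ∂P| ≤ (1 + c) * ((J : ℝ) + 1) ^ m := by
          have h2 : |∫ ω, S ω ^ k ∂P| ≤ ∫ ω, (1 + S ω ^ (2 * m)) ∂P := by
            refine (abs_integral_le_integral_abs).trans (integral_mono
              (integrable_pow_of_memLp (hSmem J) k).abs
              ((integrable_const _).add (integrable_pow_of_memLp (hSmem J) _)) fun ω ↦ ?_)
            exact abs_pow_le_one_add_pow hk' _
          rw [integral_add (integrable_const _) (integrable_pow_of_memLp (hSmem J) _)] at h2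
          have h3 := hc J
          have h4 : (J : ℝ) ^ m ≤ ((J : ℝ) + 1) ^ m :=
            pow_le_pow_left₀ (Nat.cast_nonneg _) (by linarith) m
          have h5 : (1 : ℝ) ≤ ((J : ℝ) + 1) ^ m :=
            one_le_pow₀ (by linarith [(Nat.cast_nonneg J : (0 : ℝ) ≤ J)])
          have h6 := mul_le_mul_of_nonneg_left h4 hc0
          simp only [integral_const, probReal_univ, smul_eq_mul, mul_one] at h2
          nlinarith
        have h7 : (∫ ω, S ω ^ k ∂P) * (∫ ω, ξ J ω ^ (n - k) ∂P) ≤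
            ((1 + c) * ((J : ℝ) + 1) ^ m) * M (n - k) := by
          refine (le_abs_self _).trans ?_
          rw [abs_mul]
          exact mul_le_mul h1 (hM _ _) (abs_nonneg _) ((abs_nonneg _).trans h1)
        calc _ ≤ ((1 + c) * ((J : ℝ) + 1) ^ m) * M (n - k) * (n.choose k : ℝ) :=
              mul_le_mul_of_nonneg_right h7 (Nat.cast_nonneg _)
          _ = _ := by ring
      rw [hexp, Finset.sum_range_succ, show n = (2 * m + 1) + 1 by omega, Finset.sum_range_succ,
        ← show n = (2 * m + 1) + 1 by omega]
      have e1 : n - (2 * m + 1) = 1 := by omega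
      rw [e1]
      simp only [pow_one, hmean, mul_zero, zero_mul, add_zero, Nat.sub_self, pow_zero,
        integral_const, probReal_univ, smul_eq_mul, mul_one, Nat.choose_self, Nat.cast_one]
      have hsum := Finset.sum_le_sum hlow
      rw [← Finset.sum_mul, ← hK] at hsum
      have h4 : (J : ℝ) ^ m ≤ ((J : ℝ) + 1) ^ m :=
        pow_le_pow_left₀ (Nat.cast_nonneg _) (by linarith) m
      have hJ0 : (0 : ℝ) ≤ J := Nat.cast_nonneg J
      push_cast
      -- The induction on `J` closes because `K J ^ (m + 1) + K (J + 1) ^ m ≤ K (J + 1) ^ m (J +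
      -- 1)`.
      have : (J : ℝ) ^ (m + 1) ≤ ((J : ℝ) + 1) ^ m * J := by
        rw [pow_succ]; exact mul_le_mul_of_nonneg_right h4 hJ0
      have := mul_le_mul_of_nonneg_left this hK0
      rw [pow_succ ((J : ℝ) + 1)]
      linarith

/-- Averages of independent, identically distributed, centred random variables with finite
moments decay like `J ^ (-1/2)` in every `Lᵠ`. -/
lemma hasRate_average {ξ : ℕ → Ω → ℝ} (hindep : iIndepFun ξ P)
    (hident : ∀ j, IdentDistrib (ξ j) (ξ 0) P P)
    (hmem : ∀ q : ℕ, MemLp (ξ 0) q P) (hmean : ∫ ω, ξ 0 ω ∂P = 0) :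
    HasRate P 1 (fun J ω ↦ (J : ℝ)⁻¹ * ∑ j ∈ Finset.range J, ξ j ω) := by
  have hmem' : ∀ j (q : ℕ), MemLp (ξ j) q P := fun j q ↦ (hident j).memLp_iff.2 (hmem q)
  intro q hq
  obtain ⟨c, hc0, hc⟩ := exists_integral_sum_pow_le hindep hmem'
    (fun j ↦ (hident j).integral_eq.trans hmean)
    (fun q ↦ ⟨|∫ ω, ξ 0 ω ^ q ∂P|, fun j ↦ by
      have := ((hident j).comp (measurable_id.pow_const q)).integral_eq
      simp only [Function.comp_def, id] at this
      rw [this]⟩) q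
  have hSmem : ∀ (J q : ℕ), MemLp (fun ω ↦ ∑ j ∈ Finset.range J, ξ j ω) q P := fun J q ↦
    memLp_finsetSum _ fun j _ ↦ hmem' j q
  refine ⟨Real.toNNReal (c ^ (1 / (2 * q : ℝ))), ?_⟩
  filter_upwards [eventually_ge_atTop 1] with J hJ
  have hmeas : AEStronglyMeasurable (fun ω ↦ (J : ℝ)⁻¹ * ∑ j ∈ Finset.range J, ξ j ω) P :=
    ((hSmem J 1).const_mul _).1
  refine ⟨hmeas, ?_⟩
  have hJ0 : (0 : ℝ) < J := by exact_mod_cast hJ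
  have hq0 : (0 : ℝ) < q := by exact_mod_cast Nat.pos_of_ne_zero hq
  -- On a probability space the norm of order `q` is at most that of order `2q`, and the even order
  -- is covered by the moment bound.
  refine (eLpNorm_le_eLpNorm_of_exponent_le (q := ((2 * q : ℕ) : ℝ≥0∞))
    (by exact_mod_cast (by omega : q ≤ 2 * q)) hmeas).trans ?_
  have hmemJ : MemLp (fun ω ↦ (J : ℝ)⁻¹ * ∑ j ∈ Finset.range J, ξ j ω) ((2 * q : ℕ) : ℝ≥0∞) P :=
    (hSmem J _).const_mul _
  rw [hmemJ.eLpNorm_eq_integral_rpow_norm (by simp [hq])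
    (ENNReal.natCast_ne_top _)]
  rw [pow_one, show ((Real.toNNReal (c ^ (1 / (2 * q : ℝ))) : ℝ≥0) : ℝ≥0∞) =
    ENNReal.ofReal (c ^ (1 / (2 * q : ℝ))) from rfl, ← ENNReal.ofReal_mul (by positivity)]
  · apply ENNReal.ofReal_le_ofReal
    simp only [ENNReal.toReal_natCast, Real.rpow_natCast, norm_mul, mul_pow]
    rw [integral_const_mul]
    have h1 : ∫ ω, ‖∑ j ∈ Finset.range J, ξ j ω‖ ^ (2 * q) ∂P ≤ c * (J : ℝ) ^ q := by
      simpa only [Real.norm_eq_abs, (even_two_mul q).pow_abs] using hc J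
    have h2 : ‖(J : ℝ)⁻¹‖ ^ (2 * q) * ∫ ω, ‖∑ j ∈ Finset.range J, ξ j ω‖ ^ (2 * q) ∂P
        ≤ c * ((√(J : ℝ))⁻¹) ^ (2 * q) := by
      refine (mul_le_mul_of_nonneg_left h1 (by positivity)).trans (le_of_eq ?_)
      rw [Real.norm_eq_abs, abs_of_pos (by positivity), inv_pow, inv_pow, pow_mul, pow_mul (√_),
        Real.sq_sqrt hJ0.le]
      field_simp
      ring
    refine (Real.rpow_le_rpow (by positivity) h2 (by positivity)).trans (le_of_eq ?_)
    rw [Real.mul_rpow hc0 (by positivity), ← Real.rpow_natCast, ← Real.rpow_mul (by positivity)]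
    push_cast
    rw [mul_inv_cancel₀ (by positivity), Real.rpow_one, one_div]

end Average

/-! ### The Lebesgue density of Gaussian measures -/

section Density

open scoped RealInnerProductSpace MatrixOrder

variable {ι : Type*} [Fintype ι]

/-- The quadratic form `⟨v, S v⟩`. -/
noncomputable def quadForm (S : Matrix ι ι ℝ) (v : EuclideanSpace ℝ ι) : ℝ :=
  v.ofLp ⬝ᵥ (S *ᵥ v.ofLp)

lemma measurable_quadForm (S : Matrix ι ι ℝ) : Measurable (quadForm S) := by
  unfold quadForm
  simp only [dotProduct, Matrix.mulVec]
  fun_prop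

/-- Both measures have the characteristic function `exp (-‖t‖² / 2)`, by the Fourier transform of
the Gaussian, and finite measures are determined by it. -/
lemma stdGaussian_eq_withDensity :
    stdGaussian (EuclideanSpace ℝ ι) = volume.withDensity (fun x ↦ ENNReal.ofReal
      ((√((2 * Real.pi) ^ Fintype.card ι))⁻¹ * Real.exp (-(1 / 2) * ‖x‖ ^ 2))) := by
  set E := EuclideanSpace ℝ ι
  set f : E → ℝ := fun x ↦ (√((2 * Real.pi) ^ Fintype.card ι))⁻¹ * Real.exp (-(1 / 2) * ‖x‖ ^ 2)
  have hf0 : ∀ x, 0 ≤ f x := fun x ↦ by positivity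
  have hfm : Measurable f := by fun_prop
  have hfi : Integrable f := by
    have := GaussianFourier.integrable_cexp_neg_mul_sq_norm_add (V := E) (b := 1 / 2)
      (by norm_num) 0 0
    refine Integrable.const_mul ?_ _
    convert this.re using 2 with x
    rw [zero_mul, add_zero, show -(1 / 2 : ℂ) * (‖x‖ : ℂ) ^ 2 = ((-(1 / 2) * ‖x‖ ^ 2 : ℝ) : ℂ) by
      push_cast; ring]
    exact (Complex.exp_ofReal_re _).symm
  have : IsFiniteMeasure (volume.withDensity fun x ↦ ENNReal.ofReal (f x)) :=
    isFiniteMeasure_withDensity_ofReal hfi.2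
  refine Measure.ext_of_charFun ?_
  ext t
  rw [charFun_stdGaussian, charFun_apply, integral_withDensity_eq_integral_toReal_smul
    (by fun_prop) (Eventually.of_forall fun x ↦ ENNReal.ofReal_lt_top)]
  have key := GaussianFourier.integral_cexp_neg_mul_sq_norm_add (V := E) (b := 1 / 2)
      (by norm_num) Complex.I t
  have h1 : ∀ x : E, (ENNReal.ofReal (f x)).toReal • Complex.exp (⟪x, t⟫ * Complex.I) =
      ((√((2 * Real.pi) ^ Fintype.card ι))⁻¹ : ℝ) *
        Complex.exp (-(1 / 2) * ‖x‖ ^ 2 + Complex.I * ⟪t, x⟫) := fun x ↦ by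
    rw [ENNReal.toReal_ofReal (hf0 x), Complex.real_smul, Complex.exp_add, real_inner_comm]
    simp only [f]
    push_cast
    ring_nf
  rw [integral_congr_ae (Eventually.of_forall h1), integral_const_mul, key,
    finrank_euclideanSpace, ← mul_assoc]
  have h2 : (((√((2 * Real.pi) ^ Fintype.card ι))⁻¹ : ℝ) : ℂ) *
      (Real.pi / (1 / 2)) ^ ((Fintype.card ι : ℂ) / 2) = 1 := by
    have h3 : ((Real.pi : ℂ) / (1 / 2)) ^ ((Fintype.card ι : ℂ) / 2) =
        ((√((2 * Real.pi) ^ Fintype.card ι) : ℝ) : ℂ) := by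
      rw [Real.sqrt_eq_rpow, ← Real.rpow_natCast_mul (by positivity),
        Complex.ofReal_cpow (by positivity)]
      push_cast
      congr 1 <;> ring
    rw [h3, ← Complex.ofReal_mul, inv_mul_cancel₀ (by positivity), Complex.ofReal_one]
  rw [h2, one_mul, Complex.I_sq]
  congr 1
  ring

variable [DecidableEq ι]

lemma det_toEuclideanCLM (L : Matrix ι ι ℝ) :
    LinearMap.det ((Matrix.toEuclideanCLM (𝕜 := ℝ) L : EuclideanSpace ℝ ι →L[ℝ] _) :
      EuclideanSpace ℝ ι →ₗ[ℝ] EuclideanSpace ℝ ι) = L.det := by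
  have : ((Matrix.toEuclideanCLM (𝕜 := ℝ) L : EuclideanSpace ℝ ι →L[ℝ] _) :
      EuclideanSpace ℝ ι →ₗ[ℝ] EuclideanSpace ℝ ι) =
        Matrix.toLin (EuclideanSpace.basisFun ι ℝ).toBasis (EuclideanSpace.basisFun ι ℝ).toBasis
         L := by
    rfl
  rw [this, LinearMap.det_toLin]

lemma volume_map_add_toEuclideanCLM (m : EuclideanSpace ℝ ι) {L : Matrix ι ι ℝ} (hL : L.det ≠ 0) :
    (volume : Measure (EuclideanSpace ℝ ι)) = ENNReal.ofReal |L.det| •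
      volume.map (fun x ↦ m + Matrix.toEuclideanCLM (𝕜 := ℝ) L x) := by
  have h1 : (fun x ↦ m + Matrix.toEuclideanCLM (𝕜 := ℝ) L x) =
      (fun x ↦ m + x) ∘ (Matrix.toEuclideanCLM (𝕜 := ℝ) L) := rfl
  have h2 := Measure.map_linearMap_addHaar_eq_smul_addHaar
    (volume : Measure (EuclideanSpace ℝ ι)) (f := ((Matrix.toEuclideanCLM (𝕜 := ℝ) L :
      EuclideanSpace ℝ ι →L[ℝ] _) : EuclideanSpace ℝ ι →ₗ[ℝ] EuclideanSpace ℝ ι))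
      (by rwa [det_toEuclideanCLM])
  rw [det_toEuclideanCLM] at h2
  rw [h1, ← Measure.map_map (measurable_const_add m) (by fun_prop)]
  erw [h2]
  rw [Measure.map_smul, map_add_left_eq_self, smul_smul, ← ENNReal.ofReal_mul (abs_nonneg _),
    ← abs_mul, mul_inv_cancel₀ hL]
  simp

/-- A Gaussian measure with positive definite covariance has the expected Lebesgue density. -/
lemma multivariateGaussian_eq_withDensity (m : EuclideanSpace ℝ ι) {S : Matrix ι ι ℝ}
    (hS : S.PosDef) :
    multivariateGaussian m S = volume.withDensity (fun x ↦ ENNReal.ofReal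
      ((√((2 * Real.pi) ^ Fintype.card ι * S.det))⁻¹ *
        Real.exp (-(1 / 2) * quadForm S⁻¹ (x - m)))) := by
  -- `multivariateGaussian m S` is the image of the standard Gaussian under `x ↦ m + L x`. This map
  -- turns the quadratic form of `S⁻¹` into `‖x‖²`, and its Jacobian `|det L|` is `√(det S)`.
  set L := CFC.sqrt S with hL
  have hLL : L * L = S := CFC.sqrt_mul_sqrt_self _ hS.posSemidef.nonneg
  have hdet : L.det * L.det = S.det := by rw [← Matrix.det_mul, hLL]
  have hS0 := hS.det_pos
  have hL0 : L.det ≠ 0 := by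
    intro h
    rw [h, mul_zero] at hdet
    exact hS0.ne hdet
  have hLH : Lᵀ = L := by
    have : L.PosSemidef := Matrix.nonneg_iff_posSemidef.1 (CFC.sqrt_nonneg S)
    simpa [Matrix.IsHermitian] using this.1
  have hLu : IsUnit L.det := isUnit_iff_ne_zero.2 hL0
  have hquad : ∀ x : EuclideanSpace ℝ ι,
      quadForm S⁻¹ (Matrix.toEuclideanCLM (𝕜 := ℝ) L x) = ‖x‖ ^ 2 := fun x ↦ by
    have h : S⁻¹ * L = L⁻¹ := by
      rw [← hLL, Matrix.mul_inv_rev, Matrix.mul_assoc, Matrix.nonsing_inv_mul _ hLu, Matrix.mul_one]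
    rw [quadForm, Matrix.ofLp_toEuclideanCLM, Matrix.mulVec_mulVec, h, dotProduct_comm,
      Matrix.dotProduct_mulVec, ← Matrix.mulVec_transpose, hLH, Matrix.mulVec_mulVec,
      Matrix.mul_nonsing_inv _ hLu, Matrix.one_mulVec, EuclideanSpace.real_norm_sq_eq]
    simp [dotProduct, sq]
  have hT : Measurable (fun x ↦ m + Matrix.toEuclideanCLM (𝕜 := ℝ) L x) := by fun_prop
  have hd : Measurable (fun x ↦ ENNReal.ofReal
      ((√((2 * Real.pi) ^ Fintype.card ι * S.det))⁻¹ *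
        Real.exp (-(1 / 2) * quadForm S⁻¹ (x - m)))) := by
    have := measurable_quadForm S⁻¹
    fun_prop
  ext s hs
  rw [multivariateGaussian, stdGaussian_eq_withDensity, Measure.map_apply hT hs,
    withDensity_apply _ (hT hs), withDensity_apply _ hs]
  conv_rhs =>
    rw [volume_map_add_toEuclideanCLM m hL0, Measure.restrict_smul, lintegral_smul_measure,
      setLIntegral_map hs hd hT, smul_eq_mul, ← lintegral_const_mul' _ _ ENNReal.ofReal_ne_top]
  refine lintegral_congr fun x ↦ ?_
  rw [add_sub_cancel_left, hquad, ← ENNReal.ofReal_mul (abs_nonneg _), ← mul_assoc]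
  congr 2
  rw [Real.sqrt_mul (by positivity), ← hdet, ← sq, Real.sqrt_sq_eq_abs]
  field_simp

/-- The Gaussian integral of a positive definite quadratic form. -/
lemma lintegral_exp_neg_quadForm {S : Matrix ι ι ℝ} (hS : S.PosDef) :
    ∫⁻ v : EuclideanSpace ℝ ι, ENNReal.ofReal (Real.exp (-(1 / 2) * quadForm S v)) =
      ENNReal.ofReal (√((2 * Real.pi) ^ Fintype.card ι / S.det)) := by
  -- The integral is read off from the total mass of the Gaussian measure whose precision matrix is
  -- `S`.
  have h1 : multivariateGaussian (0 : EuclideanSpace ℝ ι) S⁻¹ Set.univ = 1 := measure_univ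
  have hu : IsUnit S.det := isUnit_iff_ne_zero.2 hS.det_pos.ne'
  rw [multivariateGaussian_eq_withDensity _ hS.inv, withDensity_apply _ .univ,
    Measure.restrict_univ, Matrix.nonsing_inv_nonsing_inv _ hu] at h1
  simp only [sub_zero] at h1
  have hm : Measurable fun v : EuclideanSpace ℝ ι ↦
      ENNReal.ofReal (Real.exp (-(1 / 2) * quadForm S v)) := by
    have := measurable_quadForm S
    fun_prop
  have hd := hS.det_pos
  have h0 : 0 < √((2 * Real.pi) ^ Fintype.card ι / S.det) :=
    Real.sqrt_pos.2 (by positivity)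
  rw [Matrix.det_nonsing_inv, Ring.inverse_eq_inv', ← div_eq_mul_inv] at h1
  simp_rw [ENNReal.ofReal_mul (inv_nonneg.2 (Real.sqrt_nonneg _))] at h1
  rw [lintegral_const_mul _ hm, ENNReal.ofReal_inv_of_pos h0] at h1
  have := ENNReal.eq_inv_of_mul_eq_one_left (by rw [mul_comm]; exact h1)
  rwa [inv_inv] at this

end Density
/-! ### Exponential moments of empirical variances -/

section EmpiricalVariance

open scoped NNReal

variable {Ω : Type*} [MeasurableSpace Ω] {P : Measure Ω}

/-- Each pair contributes `(x - z)² ≤ 2 ((x - c)² + (z - c)²)`. The left side no longer contains the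
centre `c`, so `c` may be the empirical mean, and the increments over disjoint pairs of independent
samples are independent. -/
lemma sum_sq_sub_ge_sum_pairs (a : ℕ → ℝ) (c : ℝ) (J : ℕ) :
    (1 / 2) * ∑ i ∈ Finset.range (J / 2), (a (2 * i + 1) - a (2 * i)) ^ 2 ≤
      ∑ j ∈ Finset.range J, (a j - c) ^ 2 := by
  have h : ∀ n : ℕ, (1 / 2) * ∑ i ∈ Finset.range n, (a (2 * i + 1) - a (2 * i)) ^ 2 ≤
      ∑ j ∈ Finset.range (2 * n), (a j - c) ^ 2 := fun n ↦ by
    induction n with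
    | zero => simp
    | succ n ih =>
      rw [Finset.sum_range_succ, show 2 * (n + 1) = 2 * n + 1 + 1 by ring, Finset.sum_range_succ,
        Finset.sum_range_succ]
      nlinarith [sq_nonneg (a (2 * n + 1) - c + (a (2 * n) - c))]
  refine (h _).trans (Finset.sum_le_sum_of_subset_of_nonneg ?_ fun _ _ _ ↦ sq_nonneg _)
  exact Finset.range_subset_range.2 (Nat.mul_div_le J 2)

lemma integral_exp_neg_sq_gaussianReal (V : ℝ≥0) {s : ℝ} (hs : 0 ≤ s) :
    ∫ x, Real.exp (-s * x ^ 2) ∂(gaussianReal 0 V) = (√(1 + 2 * s * V))⁻¹ := by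
  rcases eq_or_ne V 0 with rfl | hV
  · simp
  have hV0 : (0 : ℝ) < V := by exact_mod_cast pos_iff_ne_zero.2 hV
  rw [integral_gaussianReal_eq_integral_smul hV]
  have : ∀ x : ℝ, gaussianPDFReal 0 V x • Real.exp (-s * x ^ 2) =
      (√(2 * Real.pi * V))⁻¹ * Real.exp (-(s + 1 / (2 * V)) * x ^ 2) := fun x ↦ by
    rw [gaussianPDFReal, smul_eq_mul, mul_assoc, ← Real.exp_add]
    congr 2
    field_simp
    ring
  simp_rw [this]
  rw [integral_const_mul, integral_gaussian, ← Real.sqrt_inv, ← Real.sqrt_inv,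
    ← Real.sqrt_mul (by positivity)]
  congr 1
  field_simp
  ring

lemma hasLaw_sub_gaussianReal {X Y : Ω → ℝ} {μ : ℝ} {V : ℝ≥0} (h : IndepFun X Y P)
    (hX : HasLaw X (gaussianReal μ V) P) (hY : HasLaw Y (gaussianReal μ V) P) :
    HasLaw (fun ω ↦ Y ω - X ω) (gaussianReal 0 (2 * V)) P := by
  refine ⟨hY.aemeasurable.sub hX.aemeasurable, ?_⟩
  have h1 := gaussianReal_neg hX
  have h2 : IndepFun Y (-X) P := h.symm.comp measurable_id measurable_neg
  have h3 := gaussianReal_add_gaussianReal_of_indepFun h2 hY.map_eq h1.map_eq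
  rw [add_neg_cancel, ← two_mul] at h3
  rw [← h3]
  congr 1

variable [IsProbabilityMeasure P]

/-- The exponential moment of the sum of the squared increments over disjoint pairs. -/
lemma integral_exp_neg_sum_pairs {a : ℕ → Ω → ℝ} (hindep : iIndepFun a P) {μ : ℝ} {V : ℝ≥0}
    (hlaw : ∀ j, HasLaw (a j) (gaussianReal μ V) P) {s : ℝ} (hs : 0 ≤ s) (n : ℕ) :
    ∫ ω, Real.exp (-s * ∑ i ∈ Finset.range n, (a (2 * i + 1) ω - a (2 * i) ω) ^ 2) ∂P =
      ((√(1 + 4 * s * V))⁻¹) ^ n := by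
  have hm := fun j ↦ (hlaw j).aemeasurable
  induction n with
  | zero => simp
  | succ n ih =>
    have h1 : ∫ ω, Real.exp (-s * (a (2 * n + 1) ω - a (2 * n) ω) ^ 2) ∂P =
        (√(1 + 4 * s * V))⁻¹ := by
      have := hasLaw_sub_gaussianReal (hindep.indepFun (i := 2 * n) (j := 2 * n + 1) (by omega))
        (hlaw _) (hlaw _)
      have h2 := this.integral_comp (f := fun x ↦ Real.exp (-s * x ^ 2))
        (by fun_prop)
      simp only [Function.comp_def] at h2
      rw [h2, integral_exp_neg_sq_gaussianReal _ hs]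
      push_cast
      ring_nf
    have h3 : IndepFun
        (fun ω ↦ Real.exp (-s * ∑ i ∈ Finset.range n, (a (2 * i + 1) ω - a (2 * i) ω) ^ 2))
        (fun ω ↦ Real.exp (-s * (a (2 * n + 1) ω - a (2 * n) ω) ^ 2)) P := by
      have h4 := hindep.indepFun_finset₀ (Finset.range (2 * n)) {2 * n, 2 * n + 1} (by
        rw [Finset.disjoint_left]; intro i hi; simp at hi ⊢; omega) hm
      have h5 := h4.comp
        (φ := fun f : (Finset.range (2 * n) : Finset ℕ) → ℝ ↦ Real.exp (-s * ∑ i : Fin n,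
          (f ⟨2 * i + 1, by have := i.2; simp; omega⟩ - f ⟨2 * i, by have := i.2; simp⟩) ^ 2))
        (ψ := fun f : ({2 * n, 2 * n + 1} : Finset ℕ) → ℝ ↦
          Real.exp (-s * (f ⟨2 * n + 1, by simp⟩ - f ⟨2 * n, by simp⟩) ^ 2))
        (by fun_prop) (by fun_prop)
      simpa only [Function.comp_def, Finset.sum_range] using h5
    simp_rw [Finset.sum_range_succ, mul_add, Real.exp_add]
    rw [h3.integral_fun_mul_eq_mul_integral (by fun_prop) (by fun_prop), ih, h1, pow_succ]

/-- Replaces an exponent growing with `J` by a fixed one. With `n = J / 2` and `l = n / M` one has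
`J ≤ 3 n` and `n ≤ 2 M l`, whence the factor `6`; Bernoulli's inequality bounds `(1 + t / J) ^ l`
below by `1 + t / (6 M)`. -/
lemma one_add_div_pow_ge {t : ℝ} (ht : 0 ≤ t) {M J : ℕ} (hM : 0 < M) (hJ : 2 * M ≤ J) :
    (1 + t / (6 * M)) ^ M ≤ (1 + t / J) ^ (J / 2) := by
  set n := J / 2 with hn
  set l := n / M with hl
  have hMn : M ≤ n := by omega
  have hJn : J ≤ 3 * n := by omega
  have hln : n ≤ 2 * (M * l) := by
    have h1 := Nat.div_add_mod n M
    have h2 := Nat.mod_lt n hM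
    have h3 : 1 ≤ l := (Nat.one_le_div_iff hM).2 hMn
    have h4 : M ≤ M * l := Nat.le_mul_of_pos_right _ h3
    rw [← hl] at h1
    omega
  have hJ0 : (0 : ℝ) < J := by exact_mod_cast (by omega : 0 < J)
  have hM0 : (0 : ℝ) < M := by exact_mod_cast hM
  have hlJ : (J : ℝ) ≤ 6 * (M * l) := by exact_mod_cast (by omega : J ≤ 6 * (M * l))
  have h1 : 1 + t / (6 * M) ≤ (1 + t / J) ^ l := by
    refine le_trans ?_ (one_add_mul_le_pow (by have := div_nonneg ht hJ0.le; linarith) l)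
    have : t / (6 * M) ≤ l * (t / J) := by
      rw [div_le_iff₀ (by positivity)]
      have : l * (t / J) * (6 * M) = t * ((6 * (M * l)) / J) := by ring
      rw [this]
      exact le_mul_of_one_le_right ht ((one_le_div hJ0).2 hlJ)
    linarith
  calc (1 + t / (6 * M)) ^ M ≤ ((1 + t / J) ^ l) ^ M :=
        pow_le_pow_left₀ (by positivity) h1 M
    _ = (1 + t / J) ^ (l * M) := (pow_mul _ _ _).symm
    _ ≤ (1 + t / J) ^ n := pow_le_pow_right₀ (by
        have := div_nonneg ht hJ0.le; linarith) (Nat.div_mul_le_self n M)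

/-- Bound, uniform in the number `J` of samples, on the exponential moment of the empirical
variance of Gaussian samples. -/
lemma integral_exp_neg_sum_sq_le {a : ℕ → Ω → ℝ} (hindep : iIndepFun a P) {μ : ℝ} {V : ℝ≥0}
    (hlaw : ∀ j, HasLaw (a j) (gaussianReal μ V) P) {s : ℝ} (hs : 0 ≤ s) {R J : ℕ} (hR : 0 < R)
    (hJ : 4 * R ≤ J) (c : Ω → ℝ) (hc : AEMeasurable c P) :
    ∫ ω, Real.exp (-s * ((J : ℝ)⁻¹ * ∑ j ∈ Finset.range J, (a j ω - c ω) ^ 2)) ∂P ≤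
      ((1 + s * V / (6 * R)) ^ R)⁻¹ := by
  have hm := fun j ↦ (hlaw j).aemeasurable
  have hJ0 : (0 : ℝ) < J := by exact_mod_cast (by omega : 0 < J)
  have hV0 : (0 : ℝ) ≤ V := V.2
  have hb : ∀ (f : Ω → ℝ), AEMeasurable f P → (∀ ω, 0 ≤ f ω) →
      Integrable (fun ω ↦ Real.exp (-s * f ω)) P := fun f hf hf0 ↦
    Integrable.of_bound (by fun_prop) 1 (Eventually.of_forall fun ω ↦ by
      rw [Real.norm_eq_abs, Real.abs_exp, Real.exp_le_one_iff]
      have := mul_nonneg hs (hf0 ω)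
      linarith)
  calc _ ≤ ∫ ω, Real.exp (-(s / (2 * J)) *
        ∑ i ∈ Finset.range (J / 2), (a (2 * i + 1) ω - a (2 * i) ω) ^ 2) ∂P := by
        refine integral_mono (hb _ (by fun_prop) fun ω ↦ by positivity) ?_ fun ω ↦ ?_
        · have := hb (fun ω ↦ (2 * J : ℝ)⁻¹ *
            ∑ i ∈ Finset.range (J / 2), (a (2 * i + 1) ω - a (2 * i) ω) ^ 2) (by fun_prop)
              fun ω ↦ by positivity
          convert this using 3
          ring
        · have h1 := sum_sq_sub_ge_sum_pairs (fun j ↦ a j ω) (c ω) J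
          have h2 := mul_le_mul_of_nonneg_left h1 (mul_nonneg hs (inv_nonneg.2 hJ0.le))
          refine Real.exp_le_exp.2 ?_
          have e1 : s / (2 * J) = s * (J : ℝ)⁻¹ * (1 / 2) := by field_simp
          rw [e1]
          linarith
    _ = ((√(1 + 4 * (s / (2 * J)) * V))⁻¹) ^ (J / 2) :=
        integral_exp_neg_sum_pairs hindep hlaw (by positivity) _
    _ ≤ _ := by
        rw [inv_pow]
        refine inv_anti₀ (by positivity) ?_
        -- The exponent is `2 * R` because the factors are square roots and the inequality is
        -- squared before it is compared.
        have h1 := one_add_div_pow_ge (t := 2 * (s * V)) (by positivity) (M := 2 * R) (J := J)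
          (by omega) (by omega)
        have e1 : 1 + 4 * (s / (2 * J)) * V = 1 + 2 * (s * V) / J := by
          field_simp; ring
        have e2 : 1 + 2 * (s * V) / (6 * ((2 * R : ℕ) : ℝ)) = 1 + s * V / (6 * R) := by
          push_cast; field_simp
        rw [e2] at h1
        rw [e1]
        rw [← pow_le_pow_iff_left₀ (by positivity) (by positivity) two_ne_zero, ← pow_mul,
          ← pow_mul, mul_comm R 2, mul_comm (J / 2) 2, pow_mul (√_), Real.sq_sqrt (by positivity)]
        exact h1

end EmpiricalVariance

/-! ### Empirical covariances are invertible with bounded inverse moments -/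

section EmpiricalCovariance

variable {ι κ : Type*}

/-- The coordinatewise average of the first `J` sample points. -/
noncomputable def avgVec (x : ℕ → ι → ℝ) (J : ℕ) : ι → ℝ :=
  fun a ↦ (J : ℝ)⁻¹ * ∑ j ∈ Finset.range J, x j a

/-- The empirical cross covariance of the first `J` sample points, over arbitrary index types. -/
noncomputable def covMat (x : ℕ → ι → ℝ) (z : ℕ → κ → ℝ) (J : ℕ) : Matrix ι κ ℝ :=
  Matrix.of fun a b ↦ (J : ℝ)⁻¹ * ∑ j ∈ Finset.range J,
    (x j a - avgVec x J a) * (z j b - avgVec z J b)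

variable [Fintype ι]

lemma dotProduct_covMat_mulVec (x : ℕ → ι → ℝ) (J : ℕ) (v : ι → ℝ) :
    v ⬝ᵥ (covMat x x J *ᵥ v) =
      (J : ℝ)⁻¹ * ∑ j ∈ Finset.range J, (v ⬝ᵥ x j - v ⬝ᵥ avgVec x J) ^ 2 := by
  have h : ∀ j, (v ⬝ᵥ x j - v ⬝ᵥ avgVec x J) ^ 2 =
      ∑ a, ∑ b, v a * ((x j a - avgVec x J a) * (x j b - avgVec x J b)) * v b := fun j ↦ by
    rw [← dotProduct_sub, sq, dotProduct, Finset.sum_mul_sum]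
    refine Finset.sum_congr rfl fun a _ ↦ Finset.sum_congr rfl fun b _ ↦ ?_
    simp only [Pi.sub_apply]
    ring
  simp_rw [h]
  rw [Finset.sum_comm]
  simp only [dotProduct, Matrix.mulVec, covMat, Matrix.of_apply, Finset.mul_sum]
  refine Finset.sum_congr rfl fun a _ ↦ ?_
  simp_rw [Finset.sum_comm (s := Finset.range J), Finset.sum_mul, Finset.mul_sum]
  refine Finset.sum_congr rfl fun b _ ↦ Finset.sum_congr rfl fun j _ ↦ ?_
  ring

lemma posSemidef_covMat (x : ℕ → ι → ℝ) (J : ℕ) : (covMat x x J).PosSemidef := by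
  refine Matrix.PosSemidef.of_dotProduct_mulVec_nonneg ?_ fun v ↦ ?_
  · ext a b
    simp [covMat, mul_comm]
  · rw [star_trivial, dotProduct_covMat_mulVec]
    positivity

/-- The Gaussian integral of the quadratic form of `S`. -/
noncomputable def gaussInt (S : Matrix ι ι ℝ) : ℝ≥0∞ :=
  ∫⁻ v : EuclideanSpace ℝ ι, ENNReal.ofReal (Real.exp (-(1 / 2) * quadForm S v))

variable [DecidableEq ι]

/-- For `ε > 0` the matrix `S + ε` is positive definite, so its Gaussian integral has the explicit
value, and this integral is at most that of `S`. Letting `ε → 0` covers singular `S` as well, where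
the inequality contradicts finiteness of the integral. -/
lemma le_mul_det_of_gaussInt_ne_top {S : Matrix ι ι ℝ} (hS : S.PosSemidef) (h : gaussInt S ≠ ∞) :
    (2 * Real.pi) ^ Fintype.card ι ≤ (gaussInt S).toReal ^ 2 * S.det := by
  have key : ∀ ε : ℝ, 0 < ε →
      (2 * Real.pi) ^ Fintype.card ι ≤ (gaussInt S).toReal ^ 2 * (S + ε • 1).det := fun ε hε ↦ by
    have hP : (S + ε • (1 : Matrix ι ι ℝ)).PosDef :=
      Matrix.PosDef.posSemidef_add hS (Matrix.PosDef.one.smul hε)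
    have hle : gaussInt (S + ε • (1 : Matrix ι ι ℝ)) ≤ gaussInt S := by
      refine lintegral_mono fun v ↦ ENNReal.ofReal_le_ofReal (Real.exp_le_exp.2 ?_)
      have h0 : 0 ≤ v.ofLp ⬝ᵥ v.ofLp := by
        simpa using dotProduct_star_self_nonneg v.ofLp
      simp only [quadForm, Matrix.add_mulVec, Matrix.smul_mulVec, Matrix.one_mulVec,
        dotProduct_add, dotProduct_smul, smul_eq_mul]
      nlinarith [mul_nonneg hε.le h0]
    rw [gaussInt, lintegral_exp_neg_quadForm hP, ENNReal.ofReal_le_iff_le_toReal h] at hle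
    have hd := hP.det_pos
    have h2 := pow_le_pow_left₀ (Real.sqrt_nonneg _) hle 2
    rwa [Real.sq_sqrt (by positivity), div_le_iff₀ hd] at h2
  have hc : Tendsto (fun ε : ℝ ↦ (gaussInt S).toReal ^ 2 * (S + ε • (1 : Matrix ι ι ℝ)).det)
      (𝓝[>] 0) (𝓝 ((gaussInt S).toReal ^ 2 * (S + (0 : ℝ) • (1 : Matrix ι ι ℝ)).det)) := by
    have : Continuous fun ε : ℝ ↦ (gaussInt S).toReal ^ 2 * (S + ε • (1 : Matrix ι ι ℝ)).det :=
      continuous_const.mul (Continuous.matrix_det (by fun_prop))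
    exact (this.tendsto 0).mono_left nhdsWithin_le_nhds
  rw [zero_smul, add_zero] at hc
  exact ge_of_tendsto hc (eventually_nhdsWithin_of_forall fun ε hε ↦ key ε hε)

lemma posDef_of_gaussInt_ne_top {S : Matrix ι ι ℝ} (hS : S.PosSemidef) (h : gaussInt S ≠ ∞) :
    S.PosDef := by
  rw [hS.posDef_iff_det_ne_zero]
  intro h0
  have := le_mul_det_of_gaussInt_ne_top hS h
  rw [h0, mul_zero] at this
  have h1 : 0 < (2 * Real.pi) ^ Fintype.card ι := by positivity
  linarith

-- With `L` the square root of `C`, the form is `‖L v‖²`, and `‖v‖ ≤ ‖L⁻¹‖ ‖L v‖`. This makes the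
-- exponential moments below decay in `‖v‖`.
open scoped MatrixOrder in
lemma exists_quadForm_ge {C : Matrix ι ι ℝ} (hC : C.PosDef) :
    ∃ l : ℝ, 0 < l ∧ ∀ v : EuclideanSpace ℝ ι, l * ‖v‖ ^ 2 ≤ quadForm C v := by
  set L := CFC.sqrt C with hL
  have hLL : L * L = C := CFC.sqrt_mul_sqrt_self _ hC.posSemidef.nonneg
  have hdet : L.det * L.det = C.det := by rw [← Matrix.det_mul, hLL]
  have hL0 : IsUnit L.det := isUnit_iff_ne_zero.2 fun h ↦ by
    rw [h, mul_zero] at hdet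
    exact hC.det_pos.ne hdet
  have hLH : Lᵀ = L := by
    have : L.PosSemidef := Matrix.nonneg_iff_posSemidef.1 (CFC.sqrt_nonneg C)
    simpa [Matrix.IsHermitian] using this.1
  set T := Matrix.toEuclideanCLM (𝕜 := ℝ) L
  set T' := Matrix.toEuclideanCLM (𝕜 := ℝ) L⁻¹
  have hq : ∀ v : EuclideanSpace ℝ ι, quadForm C v = ‖T v‖ ^ 2 := fun v ↦ by
    rw [EuclideanSpace.real_norm_sq_eq, quadForm, ← hLL, ← Matrix.mulVec_mulVec,
      Matrix.dotProduct_mulVec, ← Matrix.mulVec_transpose, hLH]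
    simp [T, dotProduct, sq]
  have hTT : ∀ v, T' (T v) = v := fun v ↦ by
    ext i
    simp [T, T', Matrix.mulVec_mulVec, Matrix.nonsing_inv_mul _ hL0]
  -- The added `1` keeps the constant positive even if `ι` is empty and `T' = 0`.
  refine ⟨((‖T'‖ + 1) ^ 2)⁻¹, by positivity, fun v ↦ ?_⟩
  rw [hq, inv_mul_le_iff₀ (by positivity), ← mul_pow]
  refine pow_le_pow_left₀ (norm_nonneg _) ?_ 2
  calc ‖v‖ = ‖T' (T v)‖ := by rw [hTT]
    _ ≤ ‖T'‖ * ‖T v‖ := T'.le_opNorm _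
    _ ≤ (‖T'‖ + 1) * ‖T v‖ := by gcongr; linarith

end EmpiricalCovariance

/-! ### Moments of the inverse determinant of an empirical covariance. -/

section InverseMoments

open scoped NNReal

/-- Hölder's inequality with a weight. -/
lemma lintegral_pow_le_weight {α : Type*} [MeasurableSpace α] (μ : Measure α) {f w : α → ℝ≥0∞}
    (hf : Measurable f) (hw : Measurable w) (hw0 : ∀ a, w a ≠ 0) (hw1 : ∀ a, w a ≠ ∞) (m : ℕ) :
    (∫⁻ a, f a ∂μ) ^ (m + 1) ≤
      (∫⁻ a, w a ∂μ) ^ m * ∫⁻ a, f a ^ (m + 1) * ((w a)⁻¹) ^ m ∂μ := by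
  set ν := μ.withDensity w with hν
  set g : α → ℝ≥0∞ := fun a ↦ f a * (w a)⁻¹
  have hg : Measurable g := hf.mul hw.inv
  have h1 : ∫⁻ a, f a ∂μ = ∫⁻ a, g a ∂ν := by
    rw [hν, lintegral_withDensity_eq_lintegral_mul _ hw hg]
    refine lintegral_congr fun a ↦ ?_
    simp only [Pi.mul_apply, g]
    rw [mul_comm, mul_assoc, ENNReal.inv_mul_cancel (hw0 a) (hw1 a), mul_one]
  have h2 : ∫⁻ a, f a ^ (m + 1) * ((w a)⁻¹) ^ m ∂μ = ∫⁻ a, g a ^ (m + 1) ∂ν := by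
    rw [hν, lintegral_withDensity_eq_lintegral_mul _ hw (hg.pow_const _)]
    refine lintegral_congr fun a ↦ ?_
    simp only [Pi.mul_apply, g, mul_pow, pow_succ (w a)⁻¹]
    rw [show w a * (f a ^ (m + 1) * ((w a)⁻¹ ^ m * (w a)⁻¹)) =
      f a ^ (m + 1) * (w a)⁻¹ ^ m * ((w a)⁻¹ * w a) by ring,
      ENNReal.inv_mul_cancel (hw0 a) (hw1 a), mul_one]
  have h3 : ν Set.univ = ∫⁻ a, w a ∂μ := by
    rw [hν, withDensity_apply _ .univ, Measure.restrict_univ]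
  -- Comparison of the norms of order `1` and `m + 1` of `f / w` for the measure with density `w`,
  -- whose total mass is `∫ w`.
  have h4 := eLpNorm'_le_eLpNorm'_mul_rpow_measure_univ (μ := ν) (p := 1) (q := (m + 1 : ℕ))
    one_pos (by exact_mod_cast Nat.le_add_left 1 m) hg.aestronglyMeasurable
  simp only [eLpNorm', enorm_eq_self, ENNReal.rpow_one, div_one, ENNReal.rpow_natCast] at h4
  have h5 := pow_le_pow_left₀ zero_le h4 (m + 1)
  rw [h1, h2, ← h3]
  refine h5.trans (le_of_eq ?_)
  have hm : ((m + 1 : ℕ) : ℝ) ≠ 0 := by positivity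
  rw [mul_pow, ← ENNReal.rpow_natCast, ← ENNReal.rpow_mul, ← ENNReal.rpow_natCast (_ ^ (1 - _)),
    ← ENNReal.rpow_mul, one_div, inv_mul_cancel₀ hm, ENNReal.rpow_one, sub_mul,
    inv_mul_cancel₀ hm, mul_comm]
  push_cast
  rw [one_mul, add_sub_cancel_right, ENNReal.rpow_natCast]

variable {ι : Type*} {Ω : Type*} [MeasurableSpace Ω] {P : Measure Ω}

lemma aemeasurable_covMat {κ : Type*} {x : ℕ → Ω → ι → ℝ} {z : ℕ → Ω → κ → ℝ}
    (hx : ∀ j a, AEMeasurable (fun ω ↦ x j ω a) P) (hz : ∀ j a, AEMeasurable (fun ω ↦ z j ω a) P)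
    (J : ℕ) (a : ι) (b : κ) :
    AEMeasurable (fun ω ↦ covMat (fun j ↦ x j ω) (fun j ↦ z j ω) J a b) P := by
  simp only [covMat, avgVec, Matrix.of_apply]
  fun_prop

variable [Fintype ι]

/-- All moments of the Gaussian integral of the empirical covariance are bounded uniformly in the
number of samples. -/
lemma exists_lintegral_gaussInt_pow_le [DecidableEq ι] [IsProbabilityMeasure P]
    {x : ℕ → Ω → ι → ℝ} (hindep : iIndepFun x P) {m : ι → ℝ} {C : Matrix ι ι ℝ} (hC : C.PosDef)
    (hx : ∀ j a, AEMeasurable (fun ω ↦ x j ω a) P)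
    (hlaw : ∀ j v, HasLaw (fun ω ↦ v ⬝ᵥ x j ω)
      (gaussianReal (v ⬝ᵥ m) (v ⬝ᵥ (C *ᵥ v)).toNNReal) P) (q : ℕ) :
    ∃ K : ℝ≥0∞, K ≠ ∞ ∧ ∀ᶠ J in atTop,
      ∫⁻ ω, gaussInt (covMat (fun j ↦ x j ω) (fun j ↦ x j ω) J) ^ (q + 1) ∂P ≤ K := by
  obtain ⟨l, hl0, hl⟩ := exists_quadForm_ge hC
  -- The weight `w = (1 + ‖v‖²) ^ (-r)` is integrable since `2 r` exceeds the dimension. The decay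
  -- exponent `R = r (q + 1)` is chosen so that dividing by `w ^ q` leaves exactly one factor `w`.
  set r := Fintype.card ι + 1 with hr
  set R := r * (q + 1) with hR
  have hR0 : 0 < R := by positivity
  set b : EuclideanSpace ℝ ι → ℝ≥0∞ := fun v ↦ ENNReal.ofReal (1 + ‖v‖ ^ 2) with hb
  have hb0 : ∀ v, b v ≠ 0 := fun v ↦ (ENNReal.ofReal_pos.2 (by positivity)).ne'
  have hb1 : ∀ v, b v ≠ ∞ := fun v ↦ ENNReal.ofReal_ne_top
  have hbm : Measurable b := by fun_prop
  set w : EuclideanSpace ℝ ι → ℝ≥0∞ := fun v ↦ (b v ^ r)⁻¹ with hw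
  have hwm : Measurable w := (hbm.pow_const r).inv
  have hw0 : ∀ v, w v ≠ 0 := fun v ↦ ENNReal.inv_ne_zero.2 (ENNReal.pow_ne_top (hb1 v))
  have hw1 : ∀ v, w v ≠ ∞ := fun v ↦ ENNReal.inv_ne_top.2 (pow_ne_zero _ (hb0 v))
  set W := ∫⁻ v, w v with hW
  have hWfin : W ≠ ∞ := by
    have hi := integrable_rpow_neg_one_add_norm_sq (E := EuclideanSpace ℝ ι) (μ := volume)
      (r := 2 * r) (by rw [finrank_euclideanSpace, hr]; push_cast; linarith [
        (Nat.cast_nonneg (Fintype.card ι) : (0 : ℝ) ≤ Fintype.card ι)])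
    have : W = ∫⁻ v : EuclideanSpace ℝ ι, ENNReal.ofReal ((1 + ‖v‖ ^ 2) ^ (-(2 * (r : ℝ)) / 2)) := by
      refine lintegral_congr fun v ↦ ?_
      simp only [hw, hb]
      rw [← ENNReal.ofReal_pow (by positivity), ← ENNReal.ofReal_inv_of_pos (by positivity),
        show -(2 * (r : ℝ)) / 2 = -(r : ℝ) by ring, Real.rpow_neg (by positivity),
        Real.rpow_natCast]
    rw [this]
    exact hi.lintegral_lt_top.ne
  set s : ℝ := (q + 1 : ℕ) / 2 with hs
  have hs0 : 0 < s := by positivity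
  -- Chosen so that `t (1 + ‖v‖²) ≤ 1 + s V / (6 R)`, where `V` is the variance in the direction `v`
  -- and `V ≥ l ‖v‖²`.
  set t := min 1 (s * l / (6 * R)) with ht
  have ht0 : 0 < t := lt_min one_pos (by positivity)
  set K₀ : ℝ≥0∞ := ENNReal.ofReal ((t ^ R)⁻¹)
  refine ⟨W ^ q * (K₀ * W), by finiteness, ?_⟩
  filter_upwards [eventually_ge_atTop (4 * R)] with J hJ
  set f : Ω → EuclideanSpace ℝ ι → ℝ≥0∞ := fun ω v ↦ ENNReal.ofReal
    (Real.exp (-(1 / 2) * quadForm (covMat (fun j ↦ x j ω) (fun j ↦ x j ω) J) v)) with hf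
  have hcm := aemeasurable_covMat (P := P) hx hx J
  have hfm : ∀ ω, Measurable (f ω) := fun ω ↦ by
    have := measurable_quadForm (covMat (fun j ↦ x j ω) (fun j ↦ x j ω) J)
    fun_prop
  have hfj : AEMeasurable (Function.uncurry f) (P.prod volume) := by
    have h1 : ∀ a b, AEMeasurable (fun z : Ω × EuclideanSpace ℝ ι ↦
        covMat (fun j ↦ x j z.1) (fun j ↦ x j z.1) J a b) (P.prod volume) := fun a b ↦
      (hcm a b).comp_fst
    simp only [hf, Function.uncurry_def, quadForm, dotProduct, Matrix.mulVec]
    fun_prop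
  have hv : ∀ v, ∫⁻ ω, f ω v ^ (q + 1) ∂P ≤ K₀ * (b v ^ R)⁻¹ := fun v ↦ by
    set V := (v.ofLp ⬝ᵥ (C *ᵥ v.ofLp)).toNNReal with hV
    have hVl : l * ‖v‖ ^ 2 ≤ V := (hl v).trans (Real.le_coe_toNNReal _)
    have h1 := integral_exp_neg_sum_sq_le (P := P) (a := fun j ω ↦ v.ofLp ⬝ᵥ x j ω)
      (hindep.comp (fun _ y ↦ v.ofLp ⬝ᵥ y) fun _ ↦ by
        simp only [dotProduct]; fun_prop) (fun j ↦ hlaw j v.ofLp) hs0.le hR0 hJ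
      (fun ω ↦ v.ofLp ⬝ᵥ avgVec (fun j ↦ x j ω) J) (by
        simp only [dotProduct, avgVec]; fun_prop)
    have h2 : ∀ ω, f ω v ^ (q + 1) = ENNReal.ofReal (Real.exp (-s * ((J : ℝ)⁻¹ *
        ∑ j ∈ Finset.range J, (v.ofLp ⬝ᵥ x j ω - v.ofLp ⬝ᵥ avgVec (fun j ↦ x j ω) J) ^ 2))) :=
        fun ω ↦ by
      rw [← dotProduct_covMat_mulVec, hf, ← ENNReal.ofReal_pow (Real.exp_nonneg _),
        ← Real.exp_nat_mul]
      congr 2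
      simp only [hs, quadForm]
      ring
    simp_rw [h2]
    rw [← ofReal_integral_eq_lintegral_ofReal]
    · refine (ENNReal.ofReal_le_ofReal h1).trans ?_
      simp only [hb, K₀]
      rw [← ENNReal.ofReal_pow (by positivity), ← ENNReal.ofReal_inv_of_pos (by positivity),
        ← ENNReal.ofReal_mul (by positivity)]
      refine ENNReal.ofReal_le_ofReal ?_
      rw [← mul_inv, ← mul_pow]
      refine inv_anti₀ (by positivity) (pow_le_pow_left₀ (by positivity) ?_ R)
      have h3 : t ≤ 1 := min_le_left _ _
      have h4 : t * ‖v‖ ^ 2 ≤ s * l / (6 * R) * ‖v‖ ^ 2 :=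
        mul_le_mul_of_nonneg_right (min_le_right _ _) (by positivity)
      have h5 : s * l / (6 * R) * ‖v‖ ^ 2 ≤ s * V / (6 * R) := by
        rw [div_mul_eq_mul_div]
        refine div_le_div_of_nonneg_right ?_ (by positivity)
        rw [mul_assoc]
        exact mul_le_mul_of_nonneg_left hVl hs0.le
      linarith
    · refine Integrable.of_bound ?_ 1 (Eventually.of_forall fun ω ↦ ?_)
      · simp only [dotProduct, avgVec]
        fun_prop
      · rw [Real.norm_eq_abs, Real.abs_exp, Real.exp_le_one_iff]
        have : 0 ≤ s * ((J : ℝ)⁻¹ * ∑ j ∈ Finset.range J,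
          (v.ofLp ⬝ᵥ x j ω - v.ofLp ⬝ᵥ avgVec (fun j ↦ x j ω) J) ^ 2) := by positivity
        linarith
    · exact Eventually.of_forall fun ω ↦ (Real.exp_nonneg _)
  calc _ ≤ ∫⁻ ω, W ^ q * (∫⁻ v, f ω v ^ (q + 1) * ((w v)⁻¹) ^ q) ∂P :=
        lintegral_mono fun ω ↦ lintegral_pow_le_weight volume (hfm ω) hwm hw0 hw1 q
    _ = W ^ q * ∫⁻ v, ∫⁻ ω, f ω v ^ (q + 1) * ((w v)⁻¹) ^ q ∂P := by
        rw [lintegral_const_mul' _ _ (by finiteness), lintegral_lintegral_swap]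
        refine (hfj.pow_const _).mul ?_
        exact ((hwm.inv.pow_const q).comp measurable_snd).aemeasurable
    _ ≤ W ^ q * ∫⁻ v, K₀ * w v := by
        refine mul_le_mul' le_rfl (lintegral_mono fun v ↦ ?_)
        rw [lintegral_mul_const' _ _ (ENNReal.pow_ne_top (ENNReal.inv_ne_top.2 (hw0 v)))]
        refine (mul_le_mul' (hv v) le_rfl).trans (le_of_eq ?_)
        simp only [hw, inv_inv, hR]
        rw [pow_mul, pow_succ, ENNReal.mul_inv (Or.inl (pow_ne_zero _ (pow_ne_zero _ (hb0 v))))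
          (Or.inr (pow_ne_zero _ (hb0 v))), mul_assoc, mul_comm,
          mul_right_comm (((b v ^ r) ^ q)⁻¹),
          ENNReal.inv_mul_cancel (pow_ne_zero _ (pow_ne_zero _ (hb0 v)))
          (ENNReal.pow_ne_top (ENNReal.pow_ne_top (hb1 v))), one_mul, mul_comm]
    _ = _ := by rw [lintegral_const_mul _ hwm]

/-- The empirical covariance of Gaussian samples is almost surely positive definite, and the
inverse of its determinant has bounded moments of every order. -/
lemma posDef_covMat_and_hasRate_inv_det [DecidableEq ι] [IsProbabilityMeasure P]
    {x : ℕ → Ω → ι → ℝ} (hindep : iIndepFun x P) {m : ι → ℝ} {C : Matrix ι ι ℝ} (hC : C.PosDef)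
    (hx : ∀ j a, AEMeasurable (fun ω ↦ x j ω a) P)
    (hlaw : ∀ j v, HasLaw (fun ω ↦ v ⬝ᵥ x j ω)
      (gaussianReal (v ⬝ᵥ m) (v ⬝ᵥ (C *ᵥ v)).toNNReal) P) :
    (∀ᶠ J in atTop, ∀ᵐ ω ∂P, (covMat (fun j ↦ x j ω) (fun j ↦ x j ω) J).PosDef) ∧
      HasRate P 0 (fun J ω ↦ (covMat (fun j ↦ x j ω) (fun j ↦ x j ω) J).det⁻¹) := by
  have hmS : ∀ J, AEMeasurable
      (fun ω ↦ gaussInt (covMat (fun j ↦ x j ω) (fun j ↦ x j ω) J)) P := fun J ↦ by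
    have hcm := aemeasurable_covMat (P := P) hx hx J
    have h1 : ∀ a b, AEMeasurable (fun z : Ω × EuclideanSpace ℝ ι ↦
        covMat (fun j ↦ x j z.1) (fun j ↦ x j z.1) J a b) (P.prod volume) := fun a b ↦
      (hcm a b).comp_fst
    refine AEMeasurable.lintegral_prod_right' (f := fun z : Ω × EuclideanSpace ℝ ι ↦
      ENNReal.ofReal (Real.exp (-(1 / 2) *
        quadForm (covMat (fun j ↦ x j z.1) (fun j ↦ x j z.1) J) z.2))) ?_
    simp only [quadForm, dotProduct, Matrix.mulVec]
    fun_prop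
  have hfin : ∀ᶠ J in atTop, ∀ᵐ ω ∂P,
      gaussInt (covMat (fun j ↦ x j ω) (fun j ↦ x j ω) J) ≠ ∞ := by
    -- The first moment suffices here: a finite expectation makes the Gaussian integral almost
    -- surely finite.
    obtain ⟨K, hK, hK'⟩ := exists_lintegral_gaussInt_pow_le hindep hC hx hlaw 0
    filter_upwards [hK'] with J hJ
    simp only [zero_add, pow_one] at hJ
    exact (ae_lt_top' (hmS J) (hJ.trans_lt hK.lt_top).ne).mono fun ω h ↦ h.ne
  refine ⟨hfin.mono fun J hJ ↦ hJ.mono fun ω h ↦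
    posDef_of_gaussInt_ne_top (posSemidef_covMat _ _) h, fun q hq ↦ ?_⟩
  -- Since `(2π)ⁿ ≥ 1`, the inverse determinant is at most the square of the Gaussian integral, so
  -- its moment of order `q` needs the order `2 q`.
  obtain ⟨K, hK, hK'⟩ := exists_lintegral_gaussInt_pow_le hindep hC hx hlaw (2 * q - 1)
  rw [show 2 * q - 1 + 1 = 2 * q by omega] at hK'
  refine ⟨(K ^ (1 / (q : ℝ))).toNNReal, ?_⟩
  filter_upwards [hK', hfin] with J hJ hJfin
  have hcm := aemeasurable_covMat (P := P) hx hx J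
  refine ⟨?_, ?_⟩
  · simp only [Matrix.det_apply]
    have : AEMeasurable (fun ω ↦ (∑ σ : Equiv.Perm ι, Equiv.Perm.sign σ • ∏ i,
        covMat (fun j ↦ x j ω) (fun j ↦ x j ω) J (σ i) i)⁻¹) P := by fun_prop
    exact this.aestronglyMeasurable
  · rw [pow_zero, mul_one, ENNReal.coe_toNNReal (by finiteness),
      eLpNorm_eq_lintegral_rpow_enorm_toReal (by simpa using hq) (ENNReal.natCast_ne_top q)]
    simp only [ENNReal.toReal_natCast, ENNReal.rpow_natCast]
    refine ENNReal.rpow_le_rpow ?_ (by positivity)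
    refine le_trans (lintegral_mono_ae ?_) hJ
    filter_upwards [hJfin] with ω hω
    rw [pow_mul]
    refine pow_le_pow_left₀ zero_le ?_ q
    have hS := posSemidef_covMat (fun j ↦ x j ω) J
    have h1 := le_mul_det_of_gaussInt_ne_top hS hω
    have h2 := (posDef_of_gaussInt_ne_top hS hω).det_pos
    rw [Real.enorm_eq_ofReal (inv_nonneg.2 h2.le), ← ENNReal.ofReal_toReal hω,
      ← ENNReal.ofReal_pow ENNReal.toReal_nonneg]
    refine ENNReal.ofReal_le_ofReal ?_
    rw [inv_le_iff_one_le_mul₀ h2]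
    refine le_trans (one_le_pow₀ ?_) h1
    linarith [Real.two_le_pi]

end InverseMoments

/-! ### Gaussian random vectors -/

section GaussianVector

open scoped NNReal RealInnerProductSpace

variable {ι κ : Type*} [Fintype ι] [Fintype κ] {Ω Ω' : Type*} [MeasurableSpace Ω]
  [MeasurableSpace Ω'] {P : Measure Ω} {P' : Measure Ω'}

/-- Every linear functional of the random vector `x` is Gaussian, with the mean and variance
given by `m` and `C`. -/
def IsGaussVec (P : Measure Ω) (x : Ω → ι → ℝ) (m : ι → ℝ) (C : Matrix ι ι ℝ) : Prop :=
  ∀ v : ι → ℝ, HasLaw (fun ω ↦ v ⬝ᵥ x ω) (gaussianReal (v ⬝ᵥ m) (v ⬝ᵥ (C *ᵥ v)).toNNReal) P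

lemma IsGaussVec.affine {x : Ω → ι → ℝ} {m : ι → ℝ} {C : Matrix ι ι ℝ} (h : IsGaussVec P x m C)
    (B : Matrix κ ι ℝ) (c : κ → ℝ) :
    IsGaussVec P (fun ω ↦ B *ᵥ x ω + c) (B *ᵥ m + c) (B * C * Bᵀ) := by
  intro v
  have h1 := gaussianReal_add_const (h (Bᵀ *ᵥ v)) (v ⬝ᵥ c)
  have e : ∀ w : ι → ℝ, (Bᵀ *ᵥ v) ⬝ᵥ w = v ⬝ᵥ (B *ᵥ w) := fun w ↦ by
    rw [Matrix.mulVec_transpose, Matrix.dotProduct_mulVec]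
  simpa only [dotProduct_add, e, Matrix.mulVec_mulVec, Matrix.mul_assoc] using h1

lemma IsGaussVec.prod [IsProbabilityMeasure P] [IsProbabilityMeasure P']
    {x : Ω → ι → ℝ} {m : ι → ℝ} {C : Matrix ι ι ℝ} {x' : Ω' → κ → ℝ} {m' : κ → ℝ}
    {C' : Matrix κ κ ℝ} (hC : C.PosSemidef) (hC' : C'.PosSemidef)
    (h : IsGaussVec P x m C) (h' : IsGaussVec P' x' m' C') :
    IsGaussVec (P.prod P') (fun z ↦ Sum.elim (x z.1) (x' z.2)) (Sum.elim m m')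
      (Matrix.fromBlocks C 0 0 C') := by
  intro v
  have hX : HasLaw (fun z : Ω × Ω' ↦ (v ∘ Sum.inl) ⬝ᵥ x z.1) _ (P.prod P') :=
    (h (v ∘ Sum.inl)).comp (measurePreserving_fst (μ := P) (ν := P')).hasLaw
  have hY : HasLaw (fun z : Ω × Ω' ↦ (v ∘ Sum.inr) ⬝ᵥ x' z.2) _ (P.prod P') :=
    (h' (v ∘ Sum.inr)).comp (measurePreserving_snd (μ := P) (ν := P')).hasLaw
  have hi : IndepFun (fun z : Ω × Ω' ↦ (v ∘ Sum.inl) ⬝ᵥ x z.1)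
      (fun z : Ω × Ω' ↦ (v ∘ Sum.inr) ⬝ᵥ x' z.2) (P.prod P') :=
    indepFun_prod₀ (h (v ∘ Sum.inl)).aemeasurable (h' (v ∘ Sum.inr)).aemeasurable
  have hs := gaussianReal_add_gaussianReal_of_indepFun hi hX.map_eq hY.map_eq
  have e : ∀ (a : ι → ℝ) (b : κ → ℝ), v ⬝ᵥ Sum.elim a b =
      (v ∘ Sum.inl) ⬝ᵥ a + (v ∘ Sum.inr) ⬝ᵥ b := fun a b ↦ by
    simp [dotProduct]
  have e2 : v ⬝ᵥ (Matrix.fromBlocks C 0 0 C' *ᵥ v) =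
      (v ∘ Sum.inl) ⬝ᵥ (C *ᵥ (v ∘ Sum.inl)) + (v ∘ Sum.inr) ⬝ᵥ (C' *ᵥ (v ∘ Sum.inr)) := by
    rw [Matrix.fromBlocks_mulVec, e]
    simp
  have p1 : 0 ≤ (v ∘ Sum.inl) ⬝ᵥ (C *ᵥ (v ∘ Sum.inl)) := by
    simpa using hC.dotProduct_mulVec_nonneg (v ∘ Sum.inl)
  have p2 : 0 ≤ (v ∘ Sum.inr) ⬝ᵥ (C' *ᵥ (v ∘ Sum.inr)) := by
    simpa using hC'.dotProduct_mulVec_nonneg (v ∘ Sum.inr)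
  rw [e, e2, Real.toNNReal_add p1 p2]
  refine ⟨?_, ?_⟩
  · simp only [e]
    exact hX.aemeasurable.add hY.aemeasurable
  · rw [← hs]
    congr 1
    ext z
    simp [e]

lemma IsGaussVec.comp {x : Ω → ι → ℝ} {m : ι → ℝ} {C : Matrix ι ι ℝ} (h : IsGaussVec P x m C)
    {X : Ω' → Ω} (hX : HasLaw X P P') : IsGaussVec P' (fun ω ↦ x (X ω)) m C :=
  fun v ↦ (h v).comp hX

lemma IsGaussVec.memLp_dotProduct {x : Ω → ι → ℝ} {m : ι → ℝ} {C : Matrix ι ι ℝ}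
    (h : IsGaussVec P x m C) (v : ι → ℝ) (q : ℕ) : MemLp (fun ω ↦ v ⬝ᵥ x ω) q P := by
  have h1 : MemLp id (q : ℝ≥0∞) (P.map fun ω ↦ v ⬝ᵥ x ω) := by
    rw [(h v).map_eq]
    exact memLp_id_gaussianReal' _ (ENNReal.natCast_ne_top q)
  exact (memLp_map_measure_iff (by fun_prop) (h v).aemeasurable).1 h1

lemma IsGaussVec.memLp {x : Ω → ι → ℝ} {m : ι → ℝ} {C : Matrix ι ι ℝ}
    (h : IsGaussVec P x m C) (a : ι) (q : ℕ) : MemLp (fun ω ↦ x ω a) q P := by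
  classical
  simpa using h.memLp_dotProduct (Pi.single a 1) q

lemma IsGaussVec.integral_eq {x : Ω → ι → ℝ} {m : ι → ℝ} {C : Matrix ι ι ℝ}
    (h : IsGaussVec P x m C) (a : ι) : ∫ ω, x ω a ∂P = m a := by
  classical
  simpa using (h (Pi.single a 1)).integral_eq

/-- Polarization: the definition gives only variances of linear functionals, and the covariance of
two coordinates comes from those of their sum and difference. -/
lemma IsGaussVec.integral_mul [IsProbabilityMeasure P] {x : Ω → ι → ℝ} {m : ι → ℝ}
    {C : Matrix ι ι ℝ} (hC : C.PosSemidef) (h : IsGaussVec P x m C) (a b : ι) :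
    ∫ ω, (x ω a - m a) * (x ω b - m b) ∂P = C a b := by
  classical
  have hv : ∀ v : ι → ℝ, ∫ ω, (v ⬝ᵥ x ω - v ⬝ᵥ m) ^ 2 ∂P = v ⬝ᵥ (C *ᵥ v) := fun v ↦ by
    have h1 := (h v).variance_eq
    rw [variance_id_gaussianReal, variance_eq_integral (h v).aemeasurable, (h v).integral_eq,
      integral_id_gaussianReal] at h1
    rw [h1]
    have := hC.dotProduct_mulVec_nonneg v
    exact Real.coe_toNNReal _ (by simpa using this)
  have hi : ∀ v : ι → ℝ, Integrable (fun ω ↦ (v ⬝ᵥ x ω - v ⬝ᵥ m) ^ 2) P := fun v ↦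
    ((h.memLp_dotProduct v 2).sub (memLp_const _)).integrable_sq
  have hsymm : C b a = C a b := by
    have := congrFun (congrFun hC.1 a) b
    simpa using this
  have e : ∀ ω, (x ω a - m a) * (x ω b - m b) =
      (1 / 4) * ((((Pi.single a 1 + Pi.single b 1 : ι → ℝ) ⬝ᵥ x ω -
        (Pi.single a 1 + Pi.single b 1 : ι → ℝ) ⬝ᵥ m)) ^ 2 -
        ((Pi.single a 1 - Pi.single b 1 : ι → ℝ) ⬝ᵥ x ω -
        (Pi.single a 1 - Pi.single b 1 : ι → ℝ) ⬝ᵥ m) ^ 2) := fun ω ↦ by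
    simp only [add_dotProduct, sub_dotProduct, single_one_dotProduct]
    ring
  simp_rw [e]
  rw [integral_const_mul, integral_sub (hi _) (hi _), hv, hv]
  simp only [Matrix.mulVec_add, Matrix.mulVec_sub, add_dotProduct, sub_dotProduct,
    dotProduct_add, dotProduct_sub, single_one_dotProduct, Matrix.mulVec_single_one, Matrix.col_apply]
  rw [hsymm]
  ring

lemma IsGaussVec.integrable_mul {x : Ω → ι → ℝ} {m : ι → ℝ}
    {C : Matrix ι ι ℝ} [IsProbabilityMeasure P] (h : IsGaussVec P x m C) (a b : ι) (c d : ℝ) :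
    Integrable (fun ω ↦ (x ω a - c) * (x ω b - d)) P :=
  MemLp.integrable_mul (p := 2) (q := 2) ((by exact_mod_cast h.memLp a 2 : MemLp _ 2 P).sub
    (memLp_const c)) ((by exact_mod_cast h.memLp b 2 : MemLp _ 2 P).sub (memLp_const d))

lemma IsGaussVec.integrable_quad [IsProbabilityMeasure P] {x : Ω → ι → ℝ} {m : ι → ℝ}
    {C : Matrix ι ι ℝ} (h : IsGaussVec P x m C) (Q : Matrix ι ι ℝ) :
    Integrable (fun ω ↦ x ω ⬝ᵥ (Q *ᵥ x ω)) P := by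
  simp only [dotProduct, Matrix.mulVec, Finset.mul_sum]
  refine integrable_finsetSum _ fun a _ ↦ integrable_finsetSum _ fun b _ ↦ ?_
  have := (h.integrable_mul a b 0 0).const_mul (Q a b)
  refine this.congr (Eventually.of_forall fun ω ↦ ?_)
  simp only [sub_zero]
  ring

lemma IsGaussVec.integral_quad [IsProbabilityMeasure P] {x : Ω → ι → ℝ} {m : ι → ℝ}
    {C : Matrix ι ι ℝ} (hC : C.PosSemidef) (h : IsGaussVec P x m C) (Q : Matrix ι ι ℝ) :
    ∫ ω, x ω ⬝ᵥ (Q *ᵥ x ω) ∂P = (Q * C).trace + m ⬝ᵥ (Q *ᵥ m) := by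
  have hx1 : ∀ a, Integrable (fun ω ↦ x ω a) P := fun a ↦ by
    simpa using (h.memLp a 1).integrable (by simp)
  have hmul : ∀ a b, ∫ ω, x ω a * x ω b ∂P = C a b + m a * m b := fun a b ↦ by
    have h1 := h.integral_mul hC a b
    have e : ∀ ω, (x ω a - m a) * (x ω b - m b) =
      x ω a * x ω b - (m b * x ω a + m a * x ω b - m a * m b) := fun ω ↦ by ring
    simp_rw [e] at h1
    have hi : Integrable (fun ω ↦ x ω a * x ω b) P := by
      simpa using h.integrable_mul a b 0 0
    rw [integral_sub hi, integral_sub, integral_add, integral_const_mul, integral_const_mul,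
      h.integral_eq, h.integral_eq] at h1
    · simp only [integral_const, probReal_univ, smul_eq_mul, one_mul] at h1
      linarith
    · exact (hx1 a).const_mul _
    · exact (hx1 b).const_mul _
    · exact ((hx1 a).const_mul _).add ((hx1 b).const_mul _)
    · exact integrable_const _
    · exact (((hx1 a).const_mul _).add ((hx1 b).const_mul _)).sub (integrable_const _)
  have hsymm : ∀ a b, C b a = C a b := fun a b ↦ by
    simpa using congrFun (congrFun hC.1 a) b
  have hi : ∀ a b, Integrable (fun ω ↦ x ω a * (Q a b * x ω b)) P := fun a b ↦ by
    refine ((h.integrable_mul a b 0 0).const_mul (Q a b)).congr (Eventually.of_forall fun ω ↦ ?_)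
    simp only [sub_zero]
    ring
  simp only [dotProduct, Matrix.mulVec, Finset.mul_sum]
  rw [integral_finsetSum _ fun a _ ↦ integrable_finsetSum _ fun b _ ↦ hi a b]
  simp_rw [integral_finsetSum _ fun b _ ↦ hi _ b]
  simp only [Matrix.trace, Matrix.diag, Matrix.mul_apply]
  rw [← Finset.sum_add_distrib]
  refine Finset.sum_congr rfl fun a _ ↦ ?_
  rw [← Finset.sum_add_distrib]
  refine Finset.sum_congr rfl fun b _ ↦ ?_
  rw [hsymm a b, show (∫ ω, x ω a * (Q a b * x ω b) ∂P) = ∫ ω, Q a b * (x ω a * x ω b) ∂P from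
    integral_congr_ae (Eventually.of_forall fun ω ↦ by ring), integral_const_mul, hmul]
  ring

/-- The characteristic function at `t` depends only on the law of `⟨t, x⟩`. Hence the Gaussian
linear functionals determine the law of the vector, which `IsGaussVec.map_eq` exploits. -/
lemma charFun_map_of_isGaussVec {x : Ω → EuclideanSpace ℝ ι} (hx : AEMeasurable x P)
    {m : EuclideanSpace ℝ ι} {C : Matrix ι ι ℝ} {t : EuclideanSpace ℝ ι}
    (h : IsGaussVec P (fun ω ↦ (x ω).ofLp) m.ofLp C) :
    charFun (P.map x) t = charFun (gaussianReal (t.ofLp ⬝ᵥ m.ofLp)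
        (t.ofLp ⬝ᵥ (C *ᵥ t.ofLp)).toNNReal) 1 := by
  have e : ∀ x : EuclideanSpace ℝ ι, t.ofLp ⬝ᵥ x.ofLp = ⟪x, t⟫ := fun x ↦ by
    simp [PiLp.inner_apply, dotProduct]
  rw [charFun_apply, integral_map hx (by fun_prop), charFun_apply_real, ← (h t.ofLp).map_eq,
    integral_map (h t.ofLp).aemeasurable (by fun_prop)]
  simp [e]

variable [DecidableEq ι]

lemma isGaussVec_multivariateGaussian (m : EuclideanSpace ℝ ι) {S : Matrix ι ι ℝ}
    (hS : S.PosSemidef) : IsGaussVec (multivariateGaussian m S) (fun x ↦ x.ofLp) m.ofLp S := by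
  intro v
  have e : ∀ x : EuclideanSpace ℝ ι, v ⬝ᵥ x.ofLp = innerSL ℝ (WithLp.toLp 2 v) x := fun x ↦ by
    simp [PiLp.inner_apply, dotProduct, mul_comm]
  have h := IsGaussian.map_eq_gaussianReal (μ := multivariateGaussian m S)
    (innerSL ℝ (WithLp.toLp 2 v))
  have hmean := (innerSL ℝ (WithLp.toLp 2 v)).integral_comp_id_comm
    (IsGaussian.integrable_id (μ := multivariateGaussian m S))
  rw [integral_id_multivariateGaussian] at hmean
  rw [hmean] at h
  have h2 := covarianceBilin_self (μ := multivariateGaussian m S) IsGaussian.memLp_two_id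
    (WithLp.toLp 2 v)
  rw [covarianceBilin_multivariateGaussian hS] at h2
  have hfun : (fun x : EuclideanSpace ℝ ι ↦ v ⬝ᵥ x.ofLp) = ⇑(innerSL ℝ (WithLp.toLp 2 v)) :=
    funext e
  refine ⟨by rw [hfun]; fun_prop, ?_⟩
  rw [hfun, h, ← e]
  congr 2
  exact h2.symm

lemma IsGaussVec.map_eq {x : Ω → EuclideanSpace ℝ ι} (hx : AEMeasurable x P)
    [IsProbabilityMeasure P] {m : EuclideanSpace ℝ ι} {C : Matrix ι ι ℝ} (hC : C.PosSemidef)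
    (h : IsGaussVec P (fun ω ↦ (x ω).ofLp) m.ofLp C) :
    P.map x = multivariateGaussian m C := by
  have : IsProbabilityMeasure (P.map x) := Measure.isProbabilityMeasure_map hx
  refine Measure.ext_of_charFun ?_
  ext t
  rw [charFun_map_of_isGaussVec hx h, ← charFun_map_of_isGaussVec aemeasurable_id
    (isGaussVec_multivariateGaussian m hC), Measure.map_id]

end GaussianVector

/-! ### The Kullback-Leibler divergence between Gaussian measures -/

section GaussianKL

/-- The log-likelihood ratio is `l` almost everywhere. Nonnegativity is Gibbs' inequality, and is
what later yields `gaussKL_nonneg` without any matrix analysis. -/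
lemma klDiv_eq_of_withDensity_exp {α : Type*} [MeasurableSpace α] {μ ν : Measure α}
    [IsProbabilityMeasure μ] [IsProbabilityMeasure ν] {l : α → ℝ} (hl : Measurable l)
    (h : μ = ν.withDensity fun x ↦ ENNReal.ofReal (Real.exp (l x))) (hi : Integrable l μ) :
    klDiv μ ν = ENNReal.ofReal (∫ x, l x ∂μ) ∧ 0 ≤ ∫ x, l x ∂μ := by
  have hac : μ ≪ ν := by rw [h]; exact withDensity_absolutelyContinuous _ _
  have hr : llr μ ν =ᵐ[μ] l := by
    have h1 : μ.rnDeriv ν =ᵐ[ν] fun x ↦ ENNReal.ofReal (Real.exp (l x)) := by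
      conv_lhs => rw [h]
      exact Measure.rnDeriv_withDensity _ (by fun_prop)
    filter_upwards [hac.ae_le h1] with x hx
    rw [llr, hx, ENNReal.toReal_ofReal (Real.exp_nonneg _), Real.log_exp]
  have hnn := integral_llr_add_sub_measure_univ_nonneg hac (hi.congr hr.symm)
  rw [klDiv_of_ac_of_integrable hac (hi.congr hr.symm)]
  rw [integral_congr_ae hr] at hnn ⊢
  simpa using hnn

variable {n : ℕ}

lemma gaussianDensity_pos (m : EuclideanSpace ℝ (Fin n)) {S : Matrix (Fin n) (Fin n) ℝ}
    (hS : S.PosDef) (x : EuclideanSpace ℝ (Fin n)) : 0 < gaussianDensity m S x := by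
  have := hS.det_pos
  unfold gaussianDensity
  positivity

lemma measurable_gaussianDensity (m : EuclideanSpace ℝ (Fin n)) (S : Matrix (Fin n) (Fin n) ℝ) :
    Measurable (gaussianDensity m S) := by
  have : Measurable (quadInv S) := measurable_quadForm S⁻¹
  unfold gaussianDensity
  fun_prop

lemma multivariateGaussian_eq_withDensity_gaussianDensity (m : EuclideanSpace ℝ (Fin n))
    {S : Matrix (Fin n) (Fin n) ℝ} (hS : S.PosDef) : multivariateGaussian m S =
      volume.withDensity (fun x ↦ ENNReal.ofReal (gaussianDensity m S x)) := by
  rw [multivariateGaussian_eq_withDensity m hS, Fintype.card_fin]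
  rfl

lemma log_gaussianDensity_div (m m' : EuclideanSpace ℝ (Fin n)) {S S' : Matrix (Fin n) (Fin n) ℝ}
    (hS : S.PosDef) (hS' : S'.PosDef) (x x' : EuclideanSpace ℝ (Fin n)) :
    Real.log (gaussianDensity m S x / gaussianDensity m' S' x') =
      (1 / 2) * (Real.log S'.det - Real.log S.det + quadInv S' (x' - m') - quadInv S (x - m)) := by
  have h1 := hS.det_pos
  have h2 := hS'.det_pos
  have key : ∀ {k : ℕ} (m x : EuclideanSpace ℝ (Fin k)) (S : Matrix (Fin k) (Fin k) ℝ), 0 < S.det →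
      Real.log (gaussianDensity m S x) = -(1 / 2) * (Real.log ((2 * Real.pi) ^ k) +
        Real.log S.det + quadInv S (x - m)) := fun {k} m x S hS ↦ by
    unfold gaussianDensity
    rw [Real.log_mul (by positivity) (Real.exp_pos _).ne', Real.log_exp, Real.log_inv,
      Real.log_sqrt (by positivity), Real.log_mul (by positivity) hS.ne']
    ring
  rw [Real.log_div (gaussianDensity_pos _ hS _).ne' (gaussianDensity_pos _ hS' _).ne',
    key _ _ _ h1, key _ _ _ h2]
  ring

/-- The Kullback-Leibler divergence between Gaussian measures with covariances `C`, `C'`, whose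
means differ by `v`. -/
noncomputable def gaussKL (C C' : Matrix (Fin n) (Fin n) ℝ) (v : Fin n → ℝ) : ℝ :=
  (1 / 2) * ((C'⁻¹ * C).trace - n + (Real.log C'.det - Real.log C.det) + v ⬝ᵥ (C'⁻¹ *ᵥ v))

lemma multivariateGaussian_eq_withDensity_exp (m m' : EuclideanSpace ℝ (Fin n))
    {S S' : Matrix (Fin n) (Fin n) ℝ} (hS : S.PosDef) (hS' : S'.PosDef) :
    multivariateGaussian m S = (multivariateGaussian m' S').withDensity (fun x ↦ ENNReal.ofReal
      (Real.exp (Real.log (gaussianDensity m S x / gaussianDensity m' S' x)))) := by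
  have hm := measurable_gaussianDensity m S
  have hm' := measurable_gaussianDensity m' S'
  rw [multivariateGaussian_eq_withDensity_gaussianDensity m hS,
    multivariateGaussian_eq_withDensity_gaussianDensity m' hS',
    ← withDensity_mul _ (by fun_prop) (by fun_prop)]
  congr 1
  ext x
  have h1 := gaussianDensity_pos m hS x
  have h2 := gaussianDensity_pos m' hS' x
  simp only [Pi.mul_apply]
  rw [Real.exp_log (by positivity), ← ENNReal.ofReal_mul h2.le,
    mul_div_cancel₀ _ h2.ne']

lemma trace_inv_mul_self {S : Matrix (Fin n) (Fin n) ℝ} (hS : S.PosDef) :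
    (S⁻¹ * S).trace = n := by
  rw [Matrix.nonsing_inv_mul _ (isUnit_iff_ne_zero.2 hS.det_pos.ne'), Matrix.trace_one]
  simp

lemma IsGaussVec.integrable_quadInv {Ω : Type*} [MeasurableSpace Ω] {P : Measure Ω}
    [IsProbabilityMeasure P] {x : Ω → EuclideanSpace ℝ (Fin n)} {m : Fin n → ℝ}
    {C : Matrix (Fin n) (Fin n) ℝ} (h : IsGaussVec P (fun ω ↦ (x ω).ofLp) m C)
    (S : Matrix (Fin n) (Fin n) ℝ) : Integrable (fun ω ↦ quadInv S (x ω)) P :=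
  h.integrable_quad S⁻¹

lemma isGaussVec_sub_const {Ω : Type*} [MeasurableSpace Ω] {P : Measure Ω}
    {x : Ω → EuclideanSpace ℝ (Fin n)} {m : Fin n → ℝ}
    {C : Matrix (Fin n) (Fin n) ℝ} (h : IsGaussVec P (fun ω ↦ (x ω).ofLp) m C)
    (c : EuclideanSpace ℝ (Fin n)) :
    IsGaussVec P (fun ω ↦ (x ω - c).ofLp) (m - c.ofLp) C := by
  have := h.affine 1 (-c.ofLp)
  simpa [sub_eq_add_neg] using this

/-- The Kullback-Leibler divergence between nondegenerate Gaussian measures. -/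
lemma klDiv_multivariateGaussian (m m' : EuclideanSpace ℝ (Fin n))
    {S S' : Matrix (Fin n) (Fin n) ℝ} (hS : S.PosDef) (hS' : S'.PosDef) :
    klDiv (multivariateGaussian m S) (multivariateGaussian m' S') =
      ENNReal.ofReal (gaussKL S S' (m - m').ofLp) ∧ 0 ≤ gaussKL S S' (m - m').ofLp := by
  have hm := measurable_gaussianDensity m S
  have hm' := measurable_gaussianDensity m' S'
  have hg := isGaussVec_multivariateGaussian m hS.posSemidef
  have h1 := isGaussVec_sub_const (x := fun x ↦ x) hg m
  have h2 := isGaussVec_sub_const (x := fun x ↦ x) hg m'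
  have i1 := h1.integrable_quadInv S
  have i2 := h2.integrable_quadInv S'
  have i3 : Integrable (fun x ↦ Real.log S'.det - Real.log S.det + quadInv S' (x - m'))
      (multivariateGaussian m S) := (integrable_const _).add i2
  have key := klDiv_eq_of_withDensity_exp (by fun_prop)
    (multivariateGaussian_eq_withDensity_exp m m' hS hS') (by
      simp_rw [log_gaussianDensity_div m m' hS hS']
      exact (i3.sub i1).const_mul _)
  have hval : ∫ x, Real.log (gaussianDensity m S x / gaussianDensity m' S' x)
      ∂(multivariateGaussian m S) = gaussKL S S' (m - m').ofLp := by
    simp_rw [log_gaussianDensity_div m m' hS hS']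
    have e1 : ∫ x, quadInv S (x - m) ∂(multivariateGaussian m S) = n := by
      refine (h1.integral_quad hS.posSemidef S⁻¹).trans ?_
      rw [trace_inv_mul_self hS]
      simp
    have e2 := h2.integral_quad hS.posSemidef S'⁻¹
    rw [integral_const_mul, integral_sub i3 i1, integral_add (integrable_const _) i2, e1]
    rw [show (∫ x, quadInv S' (x - m') ∂(multivariateGaussian m S)) = _ from e2, gaussKL]
    simp only [integral_const, probReal_univ, smul_eq_mul, one_mul, WithLp.ofLp_sub]
    ring
  rwa [hval] at key

lemma gaussKL_nonneg {C C' : Matrix (Fin n) (Fin n) ℝ} (hC : C.PosDef) (hC' : C'.PosDef)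
    (v : Fin n → ℝ) : 0 ≤ gaussKL C C' v := by
  simpa using (klDiv_multivariateGaussian (WithLp.toLp 2 v) 0 hC hC').2

/-- The divergence is quadratic in the differences of the means and of the covariances. -/
lemma gaussKL_le {C C' : Matrix (Fin n) (Fin n) ℝ} (hC : C.PosDef) (hC' : C'.PosDef)
    (v : Fin n → ℝ) : gaussKL C C' v ≤
      (1 / 2) * ((C'⁻¹ * (C' - C) * (C⁻¹ * (C' - C))).trace + v ⬝ᵥ (C'⁻¹ *ᵥ v)) := by
  -- The divergence in the reverse direction, with equal means, is nonnegative. Adding it cancels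
  -- the log-determinants, so no expansion of the logarithm is needed; the remaining traces combine
  -- into the product `e`.
  have h := gaussKL_nonneg hC' hC 0
  have hu : IsUnit C.det := isUnit_iff_ne_zero.2 hC.det_pos.ne'
  have hu' : IsUnit C'.det := isUnit_iff_ne_zero.2 hC'.det_pos.ne'
  have e : C'⁻¹ * (C' - C) * (C⁻¹ * (C' - C)) = C⁻¹ * C' - 1 - 1 + C'⁻¹ * C := by
    rw [Matrix.mul_sub, Matrix.mul_sub, Matrix.nonsing_inv_mul _ hu, Matrix.nonsing_inv_mul _ hu',
      Matrix.mul_sub, Matrix.sub_mul, Matrix.mul_one, Matrix.one_mul, ← Matrix.mul_assoc,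
      Matrix.mul_assoc C'⁻¹ C, Matrix.mul_nonsing_inv _ hu, Matrix.mul_one,
      Matrix.nonsing_inv_mul _ hu']
    abel
  rw [e, Matrix.trace_add, Matrix.trace_sub, Matrix.trace_sub, Matrix.trace_one, Fintype.card_fin]
  simp only [gaussKL, zero_dotProduct] at h ⊢
  linarith

end GaussianKL

/-! ### The linear Gaussian model -/

section LinearGaussian

variable {d k : ℕ}

/-- The forward map `u ↦ A u`. -/
noncomputable def linMap (A : Matrix (Fin k) (Fin d) ℝ) (u : EuclideanSpace ℝ (Fin d)) :
    EuclideanSpace ℝ (Fin k) :=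
  WithLp.toLp 2 (A *ᵥ u.ofLp)

/-- The covariance of the data. -/
noncomputable def dataCov (S₀ : Matrix (Fin d) (Fin d) ℝ) (Γ : Matrix (Fin k) (Fin k) ℝ)
    (A : Matrix (Fin k) (Fin d) ℝ) : Matrix (Fin k) (Fin k) ℝ :=
  A * S₀ * Aᵀ + Γ

/-- The joint covariance of the parameter and the data. -/
noncomputable def jointCov (S₀ : Matrix (Fin d) (Fin d) ℝ) (Γ : Matrix (Fin k) (Fin k) ℝ)
    (A : Matrix (Fin k) (Fin d) ℝ) : Matrix (Fin d ⊕ Fin k) (Fin d ⊕ Fin k) ℝ :=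
  Matrix.fromBlocks S₀ (S₀ * Aᵀ) (A * S₀) (dataCov S₀ Γ A)

/-- The Kalman gain. -/
noncomputable def gain (S₀ : Matrix (Fin d) (Fin d) ℝ) (Γ : Matrix (Fin k) (Fin k) ℝ)
    (A : Matrix (Fin k) (Fin d) ℝ) : Matrix (Fin d) (Fin k) ℝ :=
  S₀ * Aᵀ * (dataCov S₀ Γ A)⁻¹

/-- The posterior covariance. -/
noncomputable def postCov (S₀ : Matrix (Fin d) (Fin d) ℝ) (Γ : Matrix (Fin k) (Fin k) ℝ)
    (A : Matrix (Fin k) (Fin d) ℝ) : Matrix (Fin d) (Fin d) ℝ :=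
  S₀ - gain S₀ Γ A * (S₀ * Aᵀ)ᵀ

/-- The posterior mean. -/
noncomputable def postMean (m₀ : EuclideanSpace ℝ (Fin d)) (S₀ : Matrix (Fin d) (Fin d) ℝ)
    (Γ : Matrix (Fin k) (Fin k) ℝ) (A : Matrix (Fin k) (Fin d) ℝ) (y : EuclideanSpace ℝ (Fin k)) :
    EuclideanSpace ℝ (Fin d) :=
  m₀ + WithLp.toLp 2 (gain S₀ Γ A *ᵥ (y - linMap A m₀).ofLp)

variable {S₀ : Matrix (Fin d) (Fin d) ℝ} {Γ : Matrix (Fin k) (Fin k) ℝ}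

lemma _root_.Matrix.PosDef.transpose_eq {n : Type*} {S : Matrix n n ℝ} (hS : S.PosDef) : Sᵀ = S := by
  simpa [Matrix.IsHermitian] using hS.1

lemma _root_.Matrix.PosDef.isUnit_det {n : Type*} [Fintype n] [DecidableEq n] {S : Matrix n n ℝ}
    (hS : S.PosDef) : IsUnit S.det :=
  isUnit_iff_ne_zero.2 hS.det_pos.ne'

lemma posDef_dataCov (hS₀ : S₀.PosDef) (hΓ : Γ.PosDef) (A : Matrix (Fin k) (Fin d) ℝ) :
    (dataCov S₀ Γ A).PosDef := by
  refine Matrix.PosDef.posSemidef_add ?_ hΓ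
  simpa using hS₀.posSemidef.mul_mul_conjTranspose_same A

lemma posDef_precision (hS₀ : S₀.PosDef) (hΓ : Γ.PosDef) (A : Matrix (Fin k) (Fin d) ℝ) :
    (S₀⁻¹ + Aᵀ * Γ⁻¹ * A).PosDef := by
  refine Matrix.PosDef.add_posSemidef hS₀.inv ?_
  simpa using hΓ.inv.posSemidef.conjTranspose_mul_mul_same A

/-- The Woodbury identity, linking the Kalman form of the covariance with the precision obtained by
completing the square. -/
lemma postCov_eq (hS₀ : S₀.PosDef) (hΓ : Γ.PosDef) (A : Matrix (Fin k) (Fin d) ℝ) :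
    postCov S₀ Γ A = (S₀⁻¹ + Aᵀ * Γ⁻¹ * A)⁻¹ := by
  have e : Γ⁻¹⁻¹ + A * S₀⁻¹⁻¹ * Aᵀ = dataCov S₀ Γ A := by
    rw [Matrix.nonsing_inv_nonsing_inv _ hΓ.isUnit_det,
      Matrix.nonsing_inv_nonsing_inv _ hS₀.isUnit_det, dataCov, add_comm]
  rw [Matrix.add_mul_mul_inv_eq_sub _ _ _ _ hS₀.inv.isUnit hΓ.inv.isUnit
    (e ▸ (posDef_dataCov hS₀ hΓ A).isUnit), e, Matrix.nonsing_inv_nonsing_inv _ hS₀.isUnit_det,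
    postCov, gain, Matrix.transpose_mul, Matrix.transpose_transpose, hS₀.transpose_eq]
  simp only [Matrix.mul_assoc]

lemma posDef_postCov (hS₀ : S₀.PosDef) (hΓ : Γ.PosDef) (A : Matrix (Fin k) (Fin d) ℝ) :
    (postCov S₀ Γ A).PosDef := by
  rw [postCov_eq hS₀ hΓ]
  exact (posDef_precision hS₀ hΓ A).inv

lemma postCov_inv (hS₀ : S₀.PosDef) (hΓ : Γ.PosDef) (A : Matrix (Fin k) (Fin d) ℝ) :
    (postCov S₀ Γ A)⁻¹ = S₀⁻¹ + Aᵀ * Γ⁻¹ * A := by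
  rw [postCov_eq hS₀ hΓ, Matrix.nonsing_inv_nonsing_inv _ (posDef_precision hS₀ hΓ A).isUnit_det]

/-- Identifies the linear term when the square is completed in `posteriorLaw_eq`. -/
lemma precision_mul_gain (hS₀ : S₀.PosDef) (hΓ : Γ.PosDef) (A : Matrix (Fin k) (Fin d) ℝ) :
    (S₀⁻¹ + Aᵀ * Γ⁻¹ * A) * gain S₀ Γ A = Aᵀ * Γ⁻¹ := by
  have h1 : (S₀⁻¹ + Aᵀ * Γ⁻¹ * A) * (S₀ * Aᵀ) = Aᵀ * Γ⁻¹ * dataCov S₀ Γ A := by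
    rw [dataCov, Matrix.mul_add, Matrix.add_mul, ← Matrix.mul_assoc,
      Matrix.nonsing_inv_mul _ hS₀.isUnit_det, Matrix.one_mul, Matrix.mul_assoc Aᵀ Γ⁻¹ Γ,
      Matrix.nonsing_inv_mul _ hΓ.isUnit_det, Matrix.mul_one, add_comm]
    simp only [Matrix.mul_assoc]
  rw [gain, ← Matrix.mul_assoc, h1, Matrix.mul_assoc,
    Matrix.mul_nonsing_inv _ (posDef_dataCov hS₀ hΓ A).isUnit_det, Matrix.mul_one]

lemma gain_mul_dataCov (hS₀ : S₀.PosDef) (hΓ : Γ.PosDef) (A : Matrix (Fin k) (Fin d) ℝ) :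
    gain S₀ Γ A * dataCov S₀ Γ A = S₀ * Aᵀ := by
  rw [gain, Matrix.mul_assoc, Matrix.nonsing_inv_mul _ (posDef_dataCov hS₀ hΓ A).isUnit_det,
    Matrix.mul_one]

/-- The determinant identity behind the two expressions of the expected information gain. -/
lemma log_det_sub_log_det (hS₀ : S₀.PosDef) (hΓ : Γ.PosDef) (A : Matrix (Fin k) (Fin d) ℝ) :
    Real.log S₀.det - Real.log (postCov S₀ Γ A).det =
      Real.log (dataCov S₀ Γ A).det - Real.log Γ.det := by
  have h0 := hS₀.det_pos
  have h1 := hΓ.det_pos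
  have h2 := (posDef_postCov hS₀ hΓ A).det_pos
  have h3 := (posDef_dataCov hS₀ hΓ A).det_pos
  have e1 : S₀ * (postCov S₀ Γ A)⁻¹ = 1 + (S₀ * Aᵀ * Γ⁻¹) * A := by
    rw [postCov_inv hS₀ hΓ, Matrix.mul_add, Matrix.mul_nonsing_inv _ hS₀.isUnit_det]
    simp only [Matrix.mul_assoc]
  have e2 : dataCov S₀ Γ A * Γ⁻¹ = 1 + A * (S₀ * Aᵀ * Γ⁻¹) := by
    rw [dataCov, Matrix.add_mul, Matrix.mul_nonsing_inv _ hΓ.isUnit_det, add_comm]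
    simp only [Matrix.mul_assoc]
  have e3 := congrArg Matrix.det e1
  -- Sylvester's identity `det (1 + B A) = det (1 + A B)` passes from parameter space to data space.
  rw [Matrix.det_one_add_mul_comm, ← e2, Matrix.det_mul, Matrix.det_mul, Matrix.det_nonsing_inv,
    Matrix.det_nonsing_inv, Ring.inverse_eq_inv', ← div_eq_mul_inv,
    ← div_eq_mul_inv] at e3
  rw [← Real.log_div h0.ne' h2.ne', e3, Real.log_div h3.ne' h1.ne']

/-- The Schur complement of the block `S₀` is the noise covariance `Γ`. Nondegeneracy of the joint
law is what makes the empirical joint covariance invertible. -/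
lemma posDef_jointCov (hS₀ : S₀.PosDef) (hΓ : Γ.PosDef) (A : Matrix (Fin k) (Fin d) ℝ) :
    (jointCov S₀ Γ A).PosDef := by
  let := hS₀.isUnit.invertible
  have e : jointCov S₀ Γ A = Matrix.fromBlocks S₀ (S₀ * Aᵀ) (S₀ * Aᵀ)ᴴ (dataCov S₀ Γ A) := by
    rw [jointCov]
    simp [hS₀.transpose_eq]
  have e2 : dataCov S₀ Γ A - A * S₀ * S₀⁻¹ * (S₀ * Aᵀ) = Γ := by
    rw [Matrix.mul_assoc A, Matrix.mul_nonsing_inv _ hS₀.isUnit_det, Matrix.mul_one, dataCov,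
      Matrix.mul_assoc, add_sub_cancel_left]
  have hp : (jointCov S₀ Γ A).PosSemidef := by
    rw [e, Matrix.PosDef.fromBlocks₁₁ _ _ hS₀]
    have e3 : (S₀ * Aᵀ)ᴴ = A * S₀ := by simp [hS₀.transpose_eq]
    rw [e3, e2]
    exact hΓ.posSemidef
  rw [hp.posDef_iff_det_ne_zero, jointCov, Matrix.det_fromBlocks₁₁, Matrix.invOf_eq_nonsing_inv, e2]
  exact mul_ne_zero hS₀.det_pos.ne' hΓ.det_pos.ne'

variable (m₀ : EuclideanSpace ℝ (Fin d))

lemma measurable_linMap (A : Matrix (Fin k) (Fin d) ℝ) : Measurable (linMap A) := by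
  unfold linMap
  refine (WithLp.measurable_toLp 2 _).comp ?_
  fun_prop

instance (A : Matrix (Fin k) (Fin d) ℝ) : IsProbabilityMeasure (jointLaw m₀ S₀ Γ (linMap A)) := by
  have := measurable_linMap A
  exact Measure.isProbabilityMeasure_map (by fun_prop)

instance (A : Matrix (Fin k) (Fin d) ℝ) :
    IsProbabilityMeasure (marginalLaw m₀ S₀ Γ (linMap A)) := by
  unfold marginalLaw
  infer_instance

lemma isGaussVec_jointLaw (hS₀ : S₀.PosDef) (hΓ : Γ.PosDef) (A : Matrix (Fin k) (Fin d) ℝ) :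
    IsGaussVec (jointLaw m₀ S₀ Γ (linMap A)) (fun z ↦ Sum.elim z.1.ofLp z.2.ofLp)
      (Sum.elim m₀.ofLp (linMap A m₀).ofLp) (jointCov S₀ Γ A) := by
  have hm := measurable_linMap A
  have h1 := (isGaussVec_multivariateGaussian m₀ hS₀.posSemidef).prod hS₀.posSemidef
    hΓ.posSemidef (isGaussVec_multivariateGaussian 0 hΓ.posSemidef)
  have h2 := h1.affine (Matrix.fromBlocks (1 : Matrix (Fin d) (Fin d) ℝ) 0 A (1 : Matrix (Fin k) (Fin k) ℝ)) 0
  have e : Matrix.fromBlocks (1 : Matrix (Fin d) (Fin d) ℝ) 0 A 1 * Matrix.fromBlocks S₀ 0 0 Γ *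
      (Matrix.fromBlocks 1 0 A 1)ᵀ = jointCov S₀ Γ A := by
    simp [Matrix.fromBlocks_transpose, Matrix.fromBlocks_multiply, jointCov, dataCov]
  have e' : ∀ (a : Fin d → ℝ) (b : Fin k → ℝ), Matrix.fromBlocks (1 : Matrix (Fin d) (Fin d) ℝ) 0 A
      (1 : Matrix (Fin k) (Fin k) ℝ) *ᵥ Sum.elim a b + 0 = Sum.elim a (A *ᵥ a + b) := fun a b ↦ by
    rw [Matrix.fromBlocks_mulVec, Sum.elim_comp_inl, Sum.elim_comp_inr]
    simp
  simp only [e, e', WithLp.ofLp_zero, add_zero] at h2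
  intro v
  have hX : HasLaw (fun z : EuclideanSpace ℝ (Fin d) × EuclideanSpace ℝ (Fin k) ↦
      (z.1, linMap A z.1 + z.2)) (jointLaw m₀ S₀ Γ (linMap A))
      ((multivariateGaussian m₀ S₀).prod (multivariateGaussian 0 Γ)) := ⟨by fun_prop, rfl⟩
  refine HasLaw.comp_of_hasLaw_comp (X := fun z : EuclideanSpace ℝ (Fin d) ×
    EuclideanSpace ℝ (Fin k) ↦ (z.1, linMap A z.1 + z.2)) (Y := id)
    (f := fun z ↦ v ⬝ᵥ Sum.elim z.1.ofLp z.2.ofLp) ?_ hX HasLaw.id ?_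
  · simp only [dotProduct, Fintype.sum_sum_type, Sum.elim_inl, Sum.elim_inr]
    fun_prop
  · exact h2 v

/-- Residuals such as `y - A u` or `u - K' y - b` are of this form, so the mean of each quadratic
term in the bounds follows from `IsGaussVec.integral_quad`. -/
lemma isGaussVec_jointLaw_affine (hS₀ : S₀.PosDef) (hΓ : Γ.PosDef) (A : Matrix (Fin k) (Fin d) ℝ)
    {n : ℕ} (B : Matrix (Fin n) (Fin d) ℝ) (D : Matrix (Fin n) (Fin k) ℝ) (c : Fin n → ℝ) :
    IsGaussVec (jointLaw m₀ S₀ Γ (linMap A)) (fun z ↦ B *ᵥ z.1.ofLp + D *ᵥ z.2.ofLp + c)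
      (B *ᵥ m₀.ofLp + D *ᵥ (linMap A m₀).ofLp + c)
      ((B * S₀ + D * (A * S₀)) * Bᵀ + (B * (S₀ * Aᵀ) + D * dataCov S₀ Γ A) * Dᵀ) := by
  have h := (isGaussVec_jointLaw m₀ hS₀ hΓ A).affine (Matrix.fromCols B D) c
  simpa only [Matrix.fromCols_mulVec_sumElim, jointCov, Matrix.fromCols_mul_fromBlocks,
    Matrix.transpose_fromCols, Matrix.fromCols_mul_fromRows] using h

lemma marginalLaw_eq (hS₀ : S₀.PosDef) (hΓ : Γ.PosDef) (A : Matrix (Fin k) (Fin d) ℝ) :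
    marginalLaw m₀ S₀ Γ (linMap A) = multivariateGaussian (linMap A m₀) (dataCov S₀ Γ A) := by
  refine IsGaussVec.map_eq (x := Prod.snd) measurable_snd.aemeasurable
    (posDef_dataCov hS₀ hΓ A).posSemidef ?_
  simpa using isGaussVec_jointLaw_affine m₀ hS₀ hΓ A 0 (1 : Matrix (Fin k) (Fin k) ℝ) 0

/-- A Gaussian measure whose log-density with respect to another one is `f` up to a constant is
the exponential tilting of the latter by `f`. -/
lemma tilted_eq_of_withDensity {α : Type*} [MeasurableSpace α] {μ ν : Measure α}
    [IsProbabilityMeasure μ] {f l : α → ℝ} (c : ℝ) (hl : Measurable l)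
    (h : μ = ν.withDensity fun x ↦ ENNReal.ofReal (Real.exp (l x))) (hf : ∀ x, f x = l x + c) :
    ν.tilted f = μ := by
  have h1 : ∫⁻ x, ENNReal.ofReal (Real.exp (l x)) ∂ν = 1 := by
    have : μ Set.univ = 1 := measure_univ
    rwa [h, withDensity_apply _ .univ, Measure.restrict_univ] at this
  have h2 : ∫ x, Real.exp (l x) ∂ν = 1 := by
    rw [integral_eq_lintegral_of_nonneg_ae (Eventually.of_forall fun x ↦ (Real.exp_nonneg _))
      (by fun_prop), h1]
    simp
  rw [h, Measure.tilted]
  congr 1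
  ext x
  simp_rw [hf, Real.exp_add]
  rw [integral_mul_const, h2, one_mul, mul_div_assoc, div_self (Real.exp_ne_zero c), mul_one]

/-- The posterior of the linear Gaussian model is Gaussian. -/
lemma posteriorLaw_eq (hS₀ : S₀.PosDef) (hΓ : Γ.PosDef) (A : Matrix (Fin k) (Fin d) ℝ)
    (y : EuclideanSpace ℝ (Fin k)) : posteriorLaw m₀ S₀ Γ (linMap A) y =
      multivariateGaussian (postMean m₀ S₀ Γ A y) (postCov S₀ Γ A) := by
  have hP := posDef_postCov hS₀ hΓ A
  have hm := measurable_gaussianDensity (postMean m₀ S₀ Γ A y) (postCov S₀ Γ A)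
  have hm' := measurable_gaussianDensity m₀ S₀
  set r := (y - linMap A m₀).ofLp with hr
  set K := gain S₀ Γ A with hK
  -- The constant collects the terms independent of `u` left after completing the square: the
  -- log-determinants, the misfit at the prior mean, and the square of the mean shift `K r` in the
  -- posterior precision.
  refine tilted_eq_of_withDensity (-(1 / 2) * (Real.log S₀.det - Real.log (postCov S₀ Γ A).det
    + r ⬝ᵥ (Γ⁻¹ *ᵥ r) - (K *ᵥ r) ⬝ᵥ ((S₀⁻¹ + Aᵀ * Γ⁻¹ * A) *ᵥ (K *ᵥ r)))) (by fun_prop)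
    (multivariateGaussian_eq_withDensity_exp _ m₀ hP hS₀) fun u ↦ ?_
  rw [log_gaussianDensity_div _ _ hP hS₀]
  set w := (u - m₀).ofLp with hw
  have e1 : (y - linMap A u).ofLp = r - A *ᵥ w := by
    simp only [hr, hw, linMap, WithLp.ofLp_sub, Matrix.mulVec_sub]
    abel
  have e2 : (u - postMean m₀ S₀ Γ A y).ofLp = w - K *ᵥ r := by
    simp only [postMean, hw, hr, WithLp.ofLp_sub, WithLp.ofLp_add]
    abel
  have hΛK : (S₀⁻¹ + Aᵀ * Γ⁻¹ * A) *ᵥ (K *ᵥ r) = (Aᵀ * Γ⁻¹) *ᵥ r := by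
    rw [Matrix.mulVec_mulVec, precision_mul_gain hS₀ hΓ]
  have hsΛ : (S₀⁻¹ + Aᵀ * Γ⁻¹ * A)ᵀ = S₀⁻¹ + Aᵀ * Γ⁻¹ * A := (posDef_precision hS₀ hΓ A).transpose_eq
  have hsΓ : Γ⁻¹ᵀ = Γ⁻¹ := hΓ.inv.transpose_eq
  simp only [quadInv, e1, e2, postCov_inv hS₀ hΓ]
  have c1 : (K *ᵥ r) ⬝ᵥ ((S₀⁻¹ + Aᵀ * Γ⁻¹ * A) *ᵥ w) = w ⬝ᵥ ((Aᵀ * Γ⁻¹) *ᵥ r) := by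
    rw [Matrix.dotProduct_mulVec, ← Matrix.mulVec_transpose, hsΛ, hΛK, dotProduct_comm]
  have c2 : r ⬝ᵥ (Γ⁻¹ *ᵥ (A *ᵥ w)) = w ⬝ᵥ ((Aᵀ * Γ⁻¹) *ᵥ r) := by
    rw [Matrix.mulVec_mulVec, Matrix.dotProduct_mulVec, ← Matrix.mulVec_transpose,
      Matrix.transpose_mul, hsΓ, dotProduct_comm]
  have c3 : (A *ᵥ w) ⬝ᵥ (Γ⁻¹ *ᵥ r) = w ⬝ᵥ ((Aᵀ * Γ⁻¹) *ᵥ r) := by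
    rw [← Matrix.mulVec_mulVec, Matrix.mulVec_transpose A, dotProduct_comm w,
      ← Matrix.dotProduct_mulVec, dotProduct_comm]
  have c4 : (A *ᵥ w) ⬝ᵥ (Γ⁻¹ *ᵥ (A *ᵥ w)) = w ⬝ᵥ ((Aᵀ * Γ⁻¹ * A) *ᵥ w) := by
    rw [Matrix.mul_assoc, ← Matrix.mulVec_mulVec, Matrix.mulVec_transpose A, dotProduct_comm w,
      ← Matrix.dotProduct_mulVec, dotProduct_comm, Matrix.mulVec_mulVec]
  simp only [Matrix.mulVec_sub, dotProduct_sub, sub_dotProduct, hΛK, c1, c2, c3, c4]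
  simp only [Matrix.add_mulVec, dotProduct_add]
  ring

/-- The trace is the mean of the form `Q` at `B x` for a centred Gaussian `x` with covariance `C`.
-/
lemma trace_mul_conj_nonneg {n p : ℕ} {Q : Matrix (Fin n) (Fin n) ℝ} (hQ : Q.PosSemidef)
    {C : Matrix (Fin p) (Fin p) ℝ} (hC : C.PosSemidef) (B : Matrix (Fin n) (Fin p) ℝ) :
    0 ≤ (Q * (B * C * Bᵀ)).trace := by
  have h := (isGaussVec_multivariateGaussian 0 hC).affine B 0
  have hp : (B * C * Bᵀ).PosSemidef := by simpa using hC.mul_mul_conjTranspose_same B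
  have h2 := h.integral_quad hp Q
  simp only [WithLp.ofLp_zero, Matrix.mulVec_zero, add_zero, zero_dotProduct] at h2
  rw [← h2]
  exact integral_nonneg fun x ↦ by simpa using hQ.dotProduct_mulVec_nonneg (B *ᵥ x.ofLp)

/-- The closed form of the expected information gain of the linear Gaussian model. -/
lemma EIG_eq (hS₀ : S₀.PosDef) (hΓ : Γ.PosDef) (A : Matrix (Fin k) (Fin d) ℝ) :
    EIG m₀ S₀ Γ (linMap A) =
        ENNReal.ofReal ((1 / 2) * (Real.log S₀.det - Real.log (postCov S₀ Γ A).det)) ∧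
      0 ≤ (1 / 2) * (Real.log S₀.det - Real.log (postCov S₀ Γ A).det) := by
  have hP := posDef_postCov hS₀ hΓ A
  have hD := posDef_dataCov hS₀ hΓ A
  set K := gain S₀ Γ A with hK
  set μ := marginalLaw m₀ S₀ Γ (linMap A) with hμ
  have hkl : ∀ y, klDiv (posteriorLaw m₀ S₀ Γ (linMap A) y) (multivariateGaussian m₀ S₀) =
      ENNReal.ofReal (gaussKL (postCov S₀ Γ A) S₀ (K *ᵥ (y - linMap A m₀).ofLp)) := fun y ↦ by
    rw [posteriorLaw_eq m₀ hS₀ hΓ, (klDiv_multivariateGaussian _ _ hP hS₀).1, postMean,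
      add_sub_cancel_left]
  have hg : IsGaussVec μ (fun y ↦ K *ᵥ (y - linMap A m₀).ofLp) 0
      (K * dataCov S₀ Γ A * Kᵀ) := by
    rw [hμ, marginalLaw_eq m₀ hS₀ hΓ]
    have h1 := isGaussVec_sub_const (x := fun x ↦ x)
      (isGaussVec_multivariateGaussian (linMap A m₀) hD.posSemidef) (linMap A m₀)
    simpa using h1.affine K 0
  have hp : (K * dataCov S₀ Γ A * Kᵀ).PosSemidef := by
    simpa using hD.posSemidef.mul_mul_conjTranspose_same K
  -- Law of total variance: the posterior mean varies with covariance `S₀ - postCov`. The mean of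
  -- its quadratic term therefore cancels the trace terms of the divergence, and only the
  -- log-determinants remain.
  have hcov : K * dataCov S₀ Γ A * Kᵀ = S₀ - postCov S₀ Γ A := by
    rw [gain_mul_dataCov hS₀ hΓ, postCov, sub_sub_cancel, ← hK]
    have h2 := gain_mul_dataCov hS₀ hΓ A
    rw [← hK] at h2
    rw [← h2, Matrix.transpose_mul, hD.transpose_eq, Matrix.mul_assoc]
  have hi : Integrable (fun y ↦ gaussKL (postCov S₀ Γ A) S₀ (K *ᵥ (y - linMap A m₀).ofLp)) μ :=
    ((integrable_const _).add (hg.integrable_quad S₀⁻¹)).const_mul _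
  have h_int : ∫ y, gaussKL (postCov S₀ Γ A) S₀ (K *ᵥ (y - linMap A m₀).ofLp) ∂μ =
      (1 / 2) * (Real.log S₀.det - Real.log (postCov S₀ Γ A).det) := by
    simp only [gaussKL]
    rw [integral_const_mul, integral_add (integrable_const _) (hg.integrable_quad S₀⁻¹),
      hg.integral_quad hp, hcov, Matrix.mul_sub, Matrix.trace_sub, trace_inv_mul_self hS₀]
    simp only [integral_const, probReal_univ, smul_eq_mul, one_mul, zero_dotProduct]
    ring
  refine ⟨?_, ?_⟩
  · simp only [EIG, hkl]
    rw [← h_int, ofReal_integral_eq_lintegral_ofReal hi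
      (Eventually.of_forall fun y ↦ gaussKL_nonneg hP hS₀ _)]
  · rw [← h_int]
    exact integral_nonneg fun y ↦ gaussKL_nonneg hP hS₀ _

lemma toReal_EIG (hS₀ : S₀.PosDef) (hΓ : Γ.PosDef) (A : Matrix (Fin k) (Fin d) ℝ) :
    (EIG m₀ S₀ Γ (linMap A)).toReal =
      (1 / 2) * (Real.log S₀.det - Real.log (postCov S₀ Γ A).det) := by
  rw [(EIG_eq m₀ hS₀ hΓ A).1, ENNReal.toReal_ofReal (EIG_eq m₀ hS₀ hΓ A).2]

/-- The upper bound obtained from a Gaussian approximation of the law of the data exceeds the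
expected information gain by a Kullback-Leibler divergence. -/
lemma upper_bound_eq (hS₀ : S₀.PosDef) (hΓ : Γ.PosDef) (A : Matrix (Fin k) (Fin d) ℝ)
    {C : Matrix (Fin k) (Fin k) ℝ} (hC : C.PosDef) (m : EuclideanSpace ℝ (Fin k)) :
    Integrable (fun z ↦ Real.log (gaussianDensity (linMap A z.1) Γ z.2 / gaussianDensity m C z.2))
        (jointLaw m₀ S₀ Γ (linMap A)) ∧
      ∫ z, Real.log (gaussianDensity (linMap A z.1) Γ z.2 / gaussianDensity m C z.2)
          ∂(jointLaw m₀ S₀ Γ (linMap A)) =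
        (EIG m₀ S₀ Γ (linMap A)).toReal +
          gaussKL (dataCov S₀ Γ A) C (linMap A m₀ - m).ofLp := by
  have hD := posDef_dataCov hS₀ hΓ A
  simp_rw [log_gaussianDensity_div _ m hΓ hC]
  -- The residual `y - A u` is the noise: centred with covariance `Γ`.
  have g1 := isGaussVec_jointLaw_affine m₀ hS₀ hΓ A (-A) (1 : Matrix (Fin k) (Fin k) ℝ) 0
  have e1 : (-A * S₀ + (1 : Matrix (Fin k) (Fin k) ℝ) * (A * S₀)) * (-A)ᵀ +
      (-A * (S₀ * Aᵀ) + 1 * dataCov S₀ Γ A) *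
      (1 : Matrix (Fin k) (Fin k) ℝ)ᵀ = Γ := by
    simp [dataCov, Matrix.mul_assoc]
  have e2 : -A *ᵥ m₀.ofLp + (1 : Matrix (Fin k) (Fin k) ℝ) *ᵥ (linMap A m₀).ofLp + 0 = 0 := by
    simp [linMap, Matrix.neg_mulVec]
  rw [e1, e2] at g1
  have g2 := isGaussVec_jointLaw_affine m₀ hS₀ hΓ A 0 (1 : Matrix (Fin k) (Fin k) ℝ) (-m.ofLp)
  simp only [Matrix.zero_mul, Matrix.zero_mulVec, Matrix.one_mul, Matrix.one_mulVec, zero_add,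
    Matrix.transpose_one, Matrix.mul_one, Matrix.transpose_zero, Matrix.mul_zero] at g2
  have f1 : ∀ z : EuclideanSpace ℝ (Fin d) × EuclideanSpace ℝ (Fin k),
      quadInv Γ (z.2 - linMap A z.1) = (-A *ᵥ z.1.ofLp + (1 : Matrix (Fin k) (Fin k) ℝ) *ᵥ
        z.2.ofLp + 0) ⬝ᵥ (Γ⁻¹ *ᵥ (-A *ᵥ z.1.ofLp + (1 : Matrix (Fin k) (Fin k) ℝ) *ᵥ
        z.2.ofLp + 0)) := fun z ↦ by
    have : (z.2 - linMap A z.1).ofLp = -A *ᵥ z.1.ofLp + (1 : Matrix (Fin k) (Fin k) ℝ) *ᵥ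
        z.2.ofLp + 0 := by
      simp only [linMap, WithLp.ofLp_sub, Matrix.neg_mulVec, Matrix.one_mulVec]
      abel
    rw [quadInv, this]
  have f2 : ∀ z : EuclideanSpace ℝ (Fin d) × EuclideanSpace ℝ (Fin k),
      quadInv C (z.2 - m) = (z.2.ofLp + -m.ofLp) ⬝ᵥ (C⁻¹ *ᵥ (z.2.ofLp + -m.ofLp)) := fun z ↦ by
    rw [quadInv, WithLp.ofLp_sub, sub_eq_add_neg]
  simp_rw [f1, f2]
  have i1 := g1.integrable_quad Γ⁻¹
  have i2 := g2.integrable_quad C⁻¹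
  have i3 := (integrable_const (μ := jointLaw m₀ S₀ Γ (linMap A))
    (Real.log C.det - Real.log Γ.det)).add i2
  refine ⟨(i3.sub i1).const_mul _, ?_⟩
  rw [integral_const_mul, integral_sub (by exact i3) i1, integral_add (integrable_const _) i2,
    g1.integral_quad hΓ.posSemidef, g2.integral_quad hD.posSemidef, trace_inv_mul_self hΓ,
    toReal_EIG m₀ hS₀ hΓ, log_det_sub_log_det hS₀ hΓ, gaussKL, WithLp.ofLp_sub, ← sub_eq_add_neg]
  simp only [integral_const, probReal_univ, smul_eq_mul, one_mul, zero_dotProduct]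
  ring

/-- The gap of the lower bound obtained from a Gaussian approximation `N(K' y + b, C)` of the
posterior. -/
lemma lower_bound_eq (hS₀ : S₀.PosDef) (hΓ : Γ.PosDef) (A : Matrix (Fin k) (Fin d) ℝ)
    {C : Matrix (Fin d) (Fin d) ℝ} (hC : C.PosDef) (K' : Matrix (Fin d) (Fin k) ℝ)
    {b : Fin d → ℝ} {m : EuclideanSpace ℝ (Fin k) → EuclideanSpace ℝ (Fin d)}
    (hm : ∀ y, (m y).ofLp = K' *ᵥ y.ofLp + b) :
    Integrable (fun z ↦ Real.log (gaussianDensity (m z.2) C z.1 / gaussianDensity m₀ S₀ z.1))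
        (jointLaw m₀ S₀ Γ (linMap A)) ∧
      (EIG m₀ S₀ Γ (linMap A)).toReal -
        ∫ z, Real.log (gaussianDensity (m z.2) C z.1 / gaussianDensity m₀ S₀ z.1)
          ∂(jointLaw m₀ S₀ Γ (linMap A)) =
          gaussKL (postCov S₀ Γ A) C (m₀ - m (linMap A m₀)).ofLp + (1 / 2) * (C⁻¹ *
            ((gain S₀ Γ A - K') * dataCov S₀ Γ A * (gain S₀ Γ A - K')ᵀ)).trace := by
  have hD := posDef_dataCov hS₀ hΓ A
  have hP := posDef_postCov hS₀ hΓ A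
  simp_rw [log_gaussianDensity_div _ m₀ hC hS₀]
  have g1 := isGaussVec_jointLaw_affine m₀ hS₀ hΓ A (1 : Matrix (Fin d) (Fin d) ℝ) (-K') (-b)
  set K := gain S₀ Γ A with hK
  have hKD : K * dataCov S₀ Γ A = S₀ * Aᵀ := gain_mul_dataCov hS₀ hΓ A
  have hDK : dataCov S₀ Γ A * Kᵀ = A * S₀ := by
    have := congrArg Matrix.transpose hKD
    simpa [Matrix.transpose_mul, hD.transpose_eq, hS₀.transpose_eq] using this
  -- The residual `u - K y` of the exact gain is uncorrelated with `y`, so replacing `K` by `K'`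
  -- adds the covariance of `(K - K') y`.
  have e1 : (1 * S₀ + -K' * (A * S₀)) * (1 : Matrix (Fin d) (Fin d) ℝ)ᵀ +
      ((1 : Matrix (Fin d) (Fin d) ℝ) * (S₀ * Aᵀ) + -K' * dataCov S₀ Γ A) * (-K')ᵀ =
      postCov S₀ Γ A + (K - K') * dataCov S₀ Γ A * (K - K')ᵀ := by
    rw [postCov, ← hK, ← hKD, ← hDK]
    simp only [Matrix.transpose_mul, Matrix.transpose_sub, Matrix.transpose_one,
      Matrix.transpose_neg, hD.transpose_eq, Matrix.mul_sub, Matrix.sub_mul, Matrix.add_mul,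
      Matrix.neg_mul, Matrix.mul_neg, Matrix.mul_one, Matrix.one_mul, Matrix.mul_assoc]
    abel
  rw [e1] at g1
  have hcov : (postCov S₀ Γ A + (K - K') * dataCov S₀ Γ A * (K - K')ᵀ).PosSemidef := by
    refine hP.posSemidef.add ?_
    simpa using hD.posSemidef.mul_mul_conjTranspose_same (K - K')
  have g2 := isGaussVec_jointLaw_affine m₀ hS₀ hΓ A (1 : Matrix (Fin d) (Fin d) ℝ) 0 (-m₀.ofLp)
  simp only [Matrix.zero_mul, Matrix.zero_mulVec, Matrix.one_mul, Matrix.one_mulVec, add_zero,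
    Matrix.transpose_one, Matrix.mul_one, Matrix.transpose_zero, Matrix.mul_zero,
    add_neg_cancel] at g2
  have f1 : ∀ z : EuclideanSpace ℝ (Fin d) × EuclideanSpace ℝ (Fin k),
      quadInv C (z.1 - m z.2) = ((1 : Matrix (Fin d) (Fin d) ℝ) *ᵥ z.1.ofLp + -K' *ᵥ
        z.2.ofLp + -b) ⬝ᵥ (C⁻¹ *ᵥ ((1 : Matrix (Fin d) (Fin d) ℝ) *ᵥ z.1.ofLp + -K' *ᵥ
        z.2.ofLp + -b)) := fun z ↦ by
    have : (z.1 - m z.2).ofLp = (1 : Matrix (Fin d) (Fin d) ℝ) *ᵥ z.1.ofLp + -K' *ᵥ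
        z.2.ofLp + -b := by
      simp only [hm, WithLp.ofLp_sub, Matrix.neg_mulVec, Matrix.one_mulVec]
      abel
    rw [quadInv, this]
  have f2 : ∀ z : EuclideanSpace ℝ (Fin d) × EuclideanSpace ℝ (Fin k),
      quadInv S₀ (z.1 - m₀) = (z.1.ofLp + -m₀.ofLp) ⬝ᵥ (S₀⁻¹ *ᵥ (z.1.ofLp + -m₀.ofLp)) := fun z ↦ by
    rw [quadInv, WithLp.ofLp_sub, sub_eq_add_neg]
  have f3 : (m₀ - m (linMap A m₀)).ofLp = (1 : Matrix (Fin d) (Fin d) ℝ) *ᵥ m₀.ofLp + -K' *ᵥ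
      (linMap A m₀).ofLp + -b := by
    simp only [hm, WithLp.ofLp_sub, Matrix.neg_mulVec, Matrix.one_mulVec]
    abel
  simp_rw [f1, f2]
  have i1 := g1.integrable_quad C⁻¹
  have i2 := g2.integrable_quad S₀⁻¹
  have i3 := (integrable_const (μ := jointLaw m₀ S₀ Γ (linMap A))
    (Real.log S₀.det - Real.log C.det)).add i2
  refine ⟨(i3.sub i1).const_mul _, ?_⟩
  rw [integral_const_mul, integral_sub (by exact i3) i1, integral_add (integrable_const _) i2,
    g1.integral_quad hcov, g2.integral_quad hS₀.posSemidef, trace_inv_mul_self hS₀,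
    toReal_EIG m₀ hS₀ hΓ, gaussKL, f3, Matrix.mul_add, Matrix.trace_add]
  simp only [integral_const, probReal_univ, smul_eq_mul, one_mul, zero_dotProduct]
  ring

end LinearGaussian

/-! ### Rates for random vectors and matrices -/

section MatrixRate

variable {Ω : Type*} [MeasurableSpace Ω] {P : Measure Ω} {ι κ l : Type*}

/-- Every entry of the random matrices has the rate `e`. -/
def MatRate (P : Measure Ω) (e : ℕ) (M : ℕ → Ω → Matrix ι κ ℝ) : Prop :=
  ∀ i j, HasRate P e (fun J ω ↦ M J ω i j)

/-- Every coordinate of the random vectors has the rate `e`. -/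
def VecRate (P : Measure Ω) (e : ℕ) (v : ℕ → Ω → ι → ℝ) : Prop :=
  ∀ i, HasRate P e (fun J ω ↦ v J ω i)

lemma MatRate.sub {e : ℕ} {M N : ℕ → Ω → Matrix ι κ ℝ} (hM : MatRate P e M) (hN : MatRate P e N) :
    MatRate P e (fun J ω ↦ M J ω - N J ω) := fun i j ↦ (hM i j).sub (hN i j)

lemma MatRate.add {e : ℕ} {M N : ℕ → Ω → Matrix ι κ ℝ} (hM : MatRate P e M) (hN : MatRate P e N) :
    MatRate P e (fun J ω ↦ M J ω + N J ω) := fun i j ↦ (hM i j).add (hN i j)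

lemma MatRate.neg {e : ℕ} {M : ℕ → Ω → Matrix ι κ ℝ} (hM : MatRate P e M) :
    MatRate P e (fun J ω ↦ -M J ω) := fun i j ↦ (hM i j).neg

lemma MatRate.transpose {e : ℕ} {M : ℕ → Ω → Matrix ι κ ℝ} (hM : MatRate P e M) :
    MatRate P e (fun J ω ↦ (M J ω)ᵀ) := fun i j ↦ hM j i

lemma MatRate.mono {e e' : ℕ} {M : ℕ → Ω → Matrix ι κ ℝ} (hM : MatRate P e M) (h : e' ≤ e) :
    MatRate P e' M := fun i j ↦ (hM i j).mono h

lemma MatRate.congr {e : ℕ} {M N : ℕ → Ω → Matrix ι κ ℝ} (hM : MatRate P e M)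
    (h : ∀ᶠ J in atTop, ∀ᵐ ω ∂P, M J ω = N J ω) : MatRate P e N := fun i j ↦
  (hM i j).congr (h.mono fun J hJ ↦ hJ.mono fun ω hω ↦ by simp only [hω])

lemma VecRate.add {e : ℕ} {v w : ℕ → Ω → ι → ℝ} (hv : VecRate P e v) (hw : VecRate P e w) :
    VecRate P e (fun J ω ↦ v J ω + w J ω) := fun i ↦ (hv i).add (hw i)

lemma VecRate.sub {e : ℕ} {v w : ℕ → Ω → ι → ℝ} (hv : VecRate P e v) (hw : VecRate P e w) :
    VecRate P e (fun J ω ↦ v J ω - w J ω) := fun i ↦ (hv i).sub (hw i)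

lemma VecRate.mono {e e' : ℕ} {v : ℕ → Ω → ι → ℝ} (hv : VecRate P e v) (h : e' ≤ e) :
    VecRate P e' v := fun i ↦ (hv i).mono h

lemma MatRate.const [IsProbabilityMeasure P] (C : Matrix ι κ ℝ) : MatRate P 0 (fun _ _ ↦ C) :=
  fun _ _ ↦ HasRate.const _

lemma VecRate.const [IsProbabilityMeasure P] (c : ι → ℝ) : VecRate P 0 (fun _ _ ↦ c) :=
  fun _ ↦ HasRate.const _

lemma MatRate.of_sub_const [IsProbabilityMeasure P] {e : ℕ} {M : ℕ → Ω → Matrix ι κ ℝ}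
    {C : Matrix ι κ ℝ} (h : MatRate P e (fun J ω ↦ M J ω - C)) : MatRate P 0 M := by
  simpa using (h.mono (zero_le : 0 ≤ e)).add (MatRate.const C)

variable [Fintype κ]

lemma MatRate.mul {e e' : ℕ} {M : ℕ → Ω → Matrix l κ ℝ} {N : ℕ → Ω → Matrix κ ι ℝ}
    (hM : MatRate P e M) (hN : MatRate P e' N) :
    MatRate P (e + e') (fun J ω ↦ M J ω * N J ω) := fun i j ↦ by
  simp only [Matrix.mul_apply]
  exact HasRate.sum _ fun k _ ↦ (hM i k).mul (hN k j)

lemma MatRate.mulVec {e e' : ℕ} {M : ℕ → Ω → Matrix ι κ ℝ} {v : ℕ → Ω → κ → ℝ}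
    (hM : MatRate P e M) (hv : VecRate P e' v) :
    VecRate P (e + e') (fun J ω ↦ M J ω *ᵥ v J ω) := fun i ↦ by
  simp only [Matrix.mulVec, dotProduct]
  exact HasRate.sum _ fun k _ ↦ (hM i k).mul (hv k)

/-- Telescoping, `M N - C D = (M - C) N + C (N - D)`, with `N` bounded in every norm. -/
lemma MatRate.mul_sub_mul [IsProbabilityMeasure P] {M : ℕ → Ω → Matrix l κ ℝ}
    {N : ℕ → Ω → Matrix κ ι ℝ} {C : Matrix l κ ℝ} {D : Matrix κ ι ℝ}
    (hM : MatRate P 1 (fun J ω ↦ M J ω - C)) (hN : MatRate P 1 (fun J ω ↦ N J ω - D)) :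
    MatRate P 1 (fun J ω ↦ M J ω * N J ω - C * D) := by
  have h := (hM.mul hN.of_sub_const).add ((MatRate.const C).mul hN)
  have e : ∀ J ω, (M J ω - C) * N J ω + C * (N J ω - D) = M J ω * N J ω - C * D := fun J ω ↦ by
    rw [Matrix.sub_mul, Matrix.mul_sub]
    abel
  simpa only [e] using h

variable [Fintype ι]

lemma VecRate.dotProduct {e e' : ℕ} {v w : ℕ → Ω → ι → ℝ} (hv : VecRate P e v)
    (hw : VecRate P e' w) : HasRate P (e + e') (fun J ω ↦ v J ω ⬝ᵥ w J ω) :=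
  HasRate.sum _ fun k _ ↦ (hv k).mul (hw k)

lemma MatRate.trace {e : ℕ} {M : ℕ → Ω → Matrix ι ι ℝ} (hM : MatRate P e M) :
    HasRate P e (fun J ω ↦ (M J ω).trace) :=
  HasRate.sum _ fun k _ ↦ hM k k

variable [DecidableEq ι]

lemma MatRate.det [IsProbabilityMeasure P] {M : ℕ → Ω → Matrix ι ι ℝ} (hM : MatRate P 0 M) :
    HasRate P 0 (fun J ω ↦ (M J ω).det) := by
  simp only [Matrix.det_apply']
  exact HasRate.sum _ fun σ _ ↦ (HasRate.prod _ fun i _ ↦ hM (σ i) i).const_mul _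

/-- Cramer's rule: the entries of the adjugate are determinants, hence polynomials in the entries,
so only `1 / det` needs its own bound. -/
lemma MatRate.inv [IsProbabilityMeasure P] {M : ℕ → Ω → Matrix ι ι ℝ} (hM : MatRate P 0 M)
    (hdet : HasRate P 0 (fun J ω ↦ (M J ω).det⁻¹)) : MatRate P 0 (fun J ω ↦ (M J ω)⁻¹) := by
  intro i j
  simp only [Matrix.inv_def, Ring.inverse_eq_inv', Matrix.smul_apply, smul_eq_mul,
    Matrix.adjugate_apply]
  refine hdet.mul (MatRate.det fun a b ↦ ?_)
  simp only [Matrix.updateRow_apply]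
  split_ifs
  · exact HasRate.const _
  · exact hM a b

/-- Resolvent identity `M⁻¹ - C⁻¹ = -M⁻¹ (M - C) C⁻¹`. -/
lemma MatRate.inv_sub_inv [IsProbabilityMeasure P] {M : ℕ → Ω → Matrix ι ι ℝ} {C : Matrix ι ι ℝ}
    (hC : C.PosDef) (hM : MatRate P 1 (fun J ω ↦ M J ω - C))
    (hinv : MatRate P 0 (fun J ω ↦ (M J ω)⁻¹)) (hpos : ∀ᶠ J in atTop, ∀ᵐ ω ∂P, (M J ω).PosDef) :
    MatRate P 1 (fun J ω ↦ (M J ω)⁻¹ - C⁻¹) := by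
  refine ((hinv.mul (hM.mul (MatRate.const C⁻¹))).neg).congr ?_
  filter_upwards [hpos] with J hJ
  filter_upwards [hJ] with ω hω
  rw [Matrix.sub_mul, Matrix.mul_sub, ← Matrix.mul_assoc,
    Matrix.nonsing_inv_mul _ hω.isUnit_det, Matrix.mul_nonsing_inv _ hC.isUnit_det,
    Matrix.one_mul, Matrix.mul_one, neg_sub]

end MatrixRate

/-! ### From rates to convergence in `L²`, and the rate of the Gaussian divergence. -/

section Convergence

variable {Ω : Type*} [MeasurableSpace Ω] {P : Measure Ω}

lemma HasRate.tendstoZeroL2 {E : Type*} [TopologicalSpace E] [ENorm E] {X : ℕ → Ω → E}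
    {Y : ℕ → Ω → ℝ} (hY : HasRate P 2 Y)
    (hX : ∀ᶠ J in atTop, AEStronglyMeasurable (X J) P)
    (h : ∀ᶠ J in atTop, ∀ᵐ ω ∂P, ‖X J ω‖ₑ ≤ ‖Y J ω‖ₑ) :
    TendstoZeroL2WithRate P X (fun J ↦ (J : ℝ)⁻¹) := by
  obtain ⟨c, hc⟩ := hY 2 two_ne_zero
  have key : ∀ᶠ J : ℕ in atTop, eLpNorm (X J) 2 P ≤ ENNReal.ofReal (c * (J : ℝ)⁻¹) := by
    filter_upwards [hc, h] with J h1 h2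
    refine (eLpNorm_mono_enorm_ae h2).trans (h1.2.trans (le_of_eq ?_))
    rw [← ENNReal.ofReal_pow (by positivity), inv_pow, Real.sq_sqrt (Nat.cast_nonneg _),
      ENNReal.ofReal_mul (NNReal.coe_nonneg c), ENNReal.ofReal_coe_nnreal]
  refine ⟨?_, ?_, ?_⟩
  · filter_upwards [key, hX] with J h1 h2
    exact ⟨h2, h1.trans_lt ENNReal.ofReal_lt_top⟩
  · have ht : Tendsto (fun J : ℕ ↦ ENNReal.ofReal (c * (J : ℝ)⁻¹)) atTop (𝓝 0) := by
      have : Tendsto (fun J : ℕ ↦ (c : ℝ) * (J : ℝ)⁻¹) atTop (𝓝 (c * 0)) :=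
        (tendsto_inv_atTop_nhds_zero_nat).const_mul _
      rw [mul_zero] at this
      simpa using ENNReal.tendsto_ofReal this
    exact tendsto_of_tendsto_of_tendsto_of_le_of_le' tendsto_const_nhds ht
      (Eventually.of_forall fun _ ↦ zero_le) key
  · refine IsBigO.of_bound c (key.mono fun J hJ ↦ ?_)
    rw [Real.norm_of_nonneg ENNReal.toReal_nonneg, Real.norm_of_nonneg (by positivity)]
    exact ENNReal.toReal_le_of_le_ofReal (by positivity) hJ

lemma tendstoZeroL2_klDiv {X : ℕ → Ω → ℝ≥0∞} {Y : ℕ → Ω → ℝ} (hY : HasRate P 2 Y)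
    (h : ∀ᶠ J in atTop, ∀ᵐ ω ∂P, X J ω = ENNReal.ofReal (Y J ω)) :
    TendstoZeroL2WithRate P X (fun J ↦ (J : ℝ)⁻¹) := by
  refine hY.tendstoZeroL2 ?_ ?_
  · filter_upwards [h, hY.aestronglyMeasurable] with J h1 h2
    exact (h2.aemeasurable.ennreal_ofReal.aestronglyMeasurable).congr
      (h1.mono fun ω hω ↦ hω.symm)
  · filter_upwards [h] with J h1
    filter_upwards [h1] with ω hω
    rw [hω, enorm_eq_self]
    exact Real.ofReal_le_enorm _

lemma tendstoZeroL2_of_ae_eq {X Y : ℕ → Ω → ℝ} (hY : HasRate P 2 Y)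
    (h : ∀ᶠ J in atTop, ∀ᵐ ω ∂P, X J ω = Y J ω) :
    TendstoZeroL2WithRate P X (fun J ↦ (J : ℝ)⁻¹) := by
  have hX : HasRate P 2 X := hY.congr (h.mono fun J hJ ↦ hJ.mono fun ω hω ↦ hω.symm)
  exact hX.tendstoZeroL2 hX.aestronglyMeasurable
    (Eventually.of_forall fun _ ↦ Eventually.of_forall fun _ ↦ le_rfl)

variable [IsProbabilityMeasure P] {n : ℕ}

/-- The divergence between a Gaussian measure and a random Gaussian approximation is of the order
of the square of the error of the parameters. -/
lemma hasRate_gaussKL {C : Matrix (Fin n) (Fin n) ℝ} (hC : C.PosDef)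
    {M : ℕ → Ω → Matrix (Fin n) (Fin n) ℝ} {v : ℕ → Ω → Fin n → ℝ}
    (hM : MatRate P 1 (fun J ω ↦ M J ω - C)) (hinv : MatRate P 0 (fun J ω ↦ (M J ω)⁻¹))
    (hpos : ∀ᶠ J in atTop, ∀ᵐ ω ∂P, (M J ω).PosDef) (hv : VecRate P 1 v) :
    HasRate P 2 (fun J ω ↦ gaussKL C (M J ω) (v J ω)) := by
  have hq : HasRate P 2 (fun J ω ↦ v J ω ⬝ᵥ ((M J ω)⁻¹ *ᵥ v J ω)) := hv.dotProduct (hinv.mulVec hv)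
  have hbound : HasRate P 2 (fun J ω ↦ (1 / 2) * (((M J ω)⁻¹ * (M J ω - C) *
      (C⁻¹ * (M J ω - C))).trace + v J ω ⬝ᵥ ((M J ω)⁻¹ *ᵥ v J ω))) :=
    HasRate.const_mul (HasRate.add
      (((hinv.mul hM).mul ((MatRate.const C⁻¹).mul hM)).trace) hq) _
  refine hbound.of_abs_le ?_ ?_
  -- Only measurability of `log det` is needed: the size of the divergence is squeezed between `0`
  -- and the quadratic bound.
  · filter_upwards [hq.aestronglyMeasurable,
      ((hinv.mul (MatRate.const C)).trace).aestronglyMeasurable,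
      hM.of_sub_const.det.aestronglyMeasurable] with J h1 h2 h3
    have h4 : AEStronglyMeasurable (fun ω ↦ Real.log (M J ω).det) P :=
      (Real.measurable_log.comp_aemeasurable h3.aemeasurable).aestronglyMeasurable
    exact (((h2.sub aestronglyMeasurable_const).add
      (h4.sub aestronglyMeasurable_const)).add h1).const_mul _
  · filter_upwards [hpos] with J hJ
    filter_upwards [hJ] with ω hω
    have h0 := gaussKL_nonneg hC hω (v J ω)
    have h1 := gaussKL_le hC hω (v J ω)
    rwa [abs_of_nonneg h0, abs_of_nonneg (h0.trans h1)]

end Convergence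

/-! ### Rates for empirical means and covariances -/

section EmpiricalRate

variable {Ω : Type*} [MeasurableSpace Ω] {P : Measure Ω} [IsProbabilityMeasure P]
  {ι : Type*} {x : ℕ → Ω → ι → ℝ} {m : ι → ℝ} {C : Matrix ι ι ℝ}

/-- Recentring at a fixed vector `m` in place of the empirical mean produces an average of
independent terms and a correction that is a product of two mean errors. -/
lemma covMat_apply_eq (z : ℕ → ι → ℝ) (m : ι → ℝ) {J : ℕ} (hJ : 1 ≤ J) (a b : ι) :
    covMat z z J a b = (J : ℝ)⁻¹ * ∑ j ∈ Finset.range J, (z j a - m a) * (z j b - m b) -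
      (avgVec z J a - m a) * (avgVec z J b - m b) := by
  have hJ0 : (J : ℝ) ≠ 0 := by positivity
  have hs : ∀ a, ∑ j ∈ Finset.range J, z j a = J * avgVec z J a := fun a ↦ by
    rw [avgVec, mul_inv_cancel_left₀ hJ0]
  have e : ∀ j, (z j a - avgVec z J a) * (z j b - avgVec z J b) =
      (z j a - m a) * (z j b - m b) - (avgVec z J b - m b) * z j a - (avgVec z J a - m a) * z j b
        + (avgVec z J a * avgVec z J b - m a * m b) := fun j ↦ by ring
  simp only [covMat, Matrix.of_apply]
  simp_rw [e, Finset.sum_add_distrib, Finset.sum_sub_distrib, ← Finset.mul_sum, hs]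
  simp only [Finset.sum_const, Finset.card_range, nsmul_eq_mul]
  field_simp
  ring

variable [Fintype ι]

lemma vecRate_avgVec_sub (hindep : iIndepFun x P) (hident : ∀ j, IdentDistrib (x j) (x 0) P P)
    (hg : IsGaussVec P (x 0) m C) :
    VecRate P 1 (fun J ω ↦ avgVec (fun j ↦ x j ω) J - m) := by
  intro a
  have hf : Measurable fun v : ι → ℝ ↦ v a - m a := by fun_prop
  have h := hasRate_average (P := P) (ξ := fun j ω ↦ x j ω a - m a)
    (hindep.comp (fun _ v ↦ v a - m a) fun _ ↦ hf) (fun j ↦ (hident j).comp hf)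
    (fun q ↦ (hg.memLp a q).sub (memLp_const _)) (by
      rw [integral_sub (by simpa using (hg.memLp a 1).integrable (by simp)) (integrable_const _),
        hg.integral_eq]
      simp)
  refine h.congr ?_
  filter_upwards [eventually_ge_atTop 1] with J hJ
  refine Eventually.of_forall fun ω ↦ ?_
  have hJ0 : (J : ℝ) ≠ 0 := by positivity
  simp only [avgVec, Pi.sub_apply, Finset.sum_sub_distrib, Finset.sum_const, Finset.card_range,
    nsmul_eq_mul]
  field_simp

lemma matRate_covMat_sub (hindep : iIndepFun x P) (hident : ∀ j, IdentDistrib (x j) (x 0) P P)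
    (hg : IsGaussVec P (x 0) m C) (hC : C.PosSemidef) :
    MatRate P 1 (fun J ω ↦ covMat (fun j ↦ x j ω) (fun j ↦ x j ω) J - C) := by
  intro a b
  have hf : Measurable fun v : ι → ℝ ↦ (v a - m a) * (v b - m b) - C a b := by fun_prop
  have hmem : ∀ q : ℕ, MemLp (fun ω ↦ (x 0 ω a - m a) * (x 0 ω b - m b)) q P := fun q ↦ by
    have : ENNReal.HolderTriple ((2 * q : ℕ) : ℝ≥0∞) ((2 * q : ℕ) : ℝ≥0∞) (q : ℝ≥0∞) := by
      constructor
      push_cast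
      rw [ENNReal.mul_inv (by simp) (by simp), ← add_mul, ENNReal.inv_two_add_inv_two, one_mul]
    exact MemLp.mul (p := ((2 * q : ℕ) : ℝ≥0∞)) (q := ((2 * q : ℕ) : ℝ≥0∞))
      ((hg.memLp b (2 * q)).sub (memLp_const _)) ((hg.memLp a (2 * q)).sub (memLp_const _))
  have h := hasRate_average (P := P) (ξ := fun j ω ↦ (x j ω a - m a) * (x j ω b - m b) - C a b)
    (hindep.comp (fun _ v ↦ (v a - m a) * (v b - m b) - C a b) fun _ ↦ hf)
    (fun j ↦ (hident j).comp hf) (fun q ↦ (hmem q).sub (memLp_const _)) (by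
      rw [integral_sub (by simpa using (hmem 1).integrable (by simp)) (integrable_const _),
        hg.integral_mul hC]
      simp)
  have hv := vecRate_avgVec_sub hindep hident hg
  -- The recentring correction has rate `2`, better than required, and is weakened to rate `1`.
  refine (h.sub (((hv a).mul (hv b)).mono one_le_two)).congr ?_
  filter_upwards [eventually_ge_atTop 1] with J hJ
  refine Eventually.of_forall fun ω ↦ ?_
  have hJ0 : (J : ℝ) ≠ 0 := by positivity
  simp only [Matrix.sub_apply, covMat_apply_eq (fun j ↦ x j ω) m hJ, Pi.sub_apply,
    Finset.sum_sub_distrib, Finset.sum_const, Finset.card_range, nsmul_eq_mul]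
  field_simp
  ring

end EmpiricalRate

/-! ### The empirical Gaussian approximations -/

section Approximation

variable {d k : ℕ}

lemma ofLp_empMean {n : ℕ} (x : ℕ → EuclideanSpace ℝ (Fin n)) (J : ℕ) :
    (empMean x J).ofLp = avgVec (fun j ↦ (x j).ofLp) J := by
  ext a
  simp [empMean, avgVec]

lemma empCov_eq_covMat {a b : ℕ} (x : ℕ → EuclideanSpace ℝ (Fin a))
    (z : ℕ → EuclideanSpace ℝ (Fin b)) (J : ℕ) :
    empCov x z J = covMat (fun j ↦ (x j).ofLp) (fun j ↦ (z j).ofLp) J := by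
  ext i j
  simp only [empCov, covMat, Matrix.smul_apply, Matrix.sum_apply, Matrix.vecMulVec_apply,
    Matrix.of_apply, smul_eq_mul, WithLp.ofLp_sub, ofLp_empMean, Pi.sub_apply]

lemma covMat_sumElim (x : ℕ → EuclideanSpace ℝ (Fin d)) (z : ℕ → EuclideanSpace ℝ (Fin k)) (J : ℕ) :
    covMat (fun j ↦ Sum.elim (x j).ofLp (z j).ofLp) (fun j ↦ Sum.elim (x j).ofLp (z j).ofLp) J =
      Matrix.fromBlocks (empCov x x J) (empCov x z J) (empCov x z J)ᵀ (empCov z z J) := by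
  simp only [empCov_eq_covMat]
  ext (i | i) (j | j) <;> simp [covMat, avgVec, mul_comm]

/-- Applied to the empirical joint covariance, whose Schur complement is `approxPostCov`. The
determinant quotient carries the inverse moments over from the joint covariance, although
`approxPostCov` is not itself an empirical covariance. -/
lemma posDef_schur {n p : ℕ} {U : Matrix (Fin n) (Fin n) ℝ} {B : Matrix (Fin n) (Fin p) ℝ}
    {D : Matrix (Fin p) (Fin p) ℝ} (h : (Matrix.fromBlocks U B Bᵀ D).PosDef) :
    (U - B * D⁻¹ * Bᵀ).PosDef ∧
      (U - B * D⁻¹ * Bᵀ).det⁻¹ = D.det * (Matrix.fromBlocks U B Bᵀ D).det⁻¹ := by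
  have hD : D.PosDef := h.submatrix Sum.inr_injective
  let := hD.isUnit.invertible
  have hdet : (Matrix.fromBlocks U B Bᵀ D).det = D.det * (U - B * D⁻¹ * Bᵀ).det := by
    rw [Matrix.det_fromBlocks₂₂, Matrix.invOf_eq_nonsing_inv]
  have h0 := h.det_pos.ne'
  rw [hdet] at h0
  have hne := right_ne_zero_of_mul h0
  refine ⟨?_, ?_⟩
  · have hp : (U - B * D⁻¹ * Bᵀ).PosSemidef := by
      have := (Matrix.PosDef.fromBlocks₂₂ U B hD).1 (by simpa using h.posSemidef)
      simpa using this
    rwa [hp.posDef_iff_det_ne_zero]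
  · rw [hdet]
    field_simp [left_ne_zero_of_mul h0]

variable {m₀ : EuclideanSpace ℝ (Fin d)} {S₀ : Matrix (Fin d) (Fin d) ℝ}
  {Γ : Matrix (Fin k) (Fin k) ℝ} {A : Matrix (Fin k) (Fin d) ℝ}
  {Ω : Type*} [MeasurableSpace Ω] {P : Measure Ω} [IsProbabilityMeasure P]
  {u : ℕ → Ω → EuclideanSpace ℝ (Fin d)} {y : ℕ → Ω → EuclideanSpace ℝ (Fin k)}

/-- The samples give Gaussian approximations which are almost surely nondegenerate and whose
parameters converge with rate `J ^ (-1/2)` in every `Lᵠ`. -/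
structure GoodSamples (m₀ : EuclideanSpace ℝ (Fin d)) (S₀ : Matrix (Fin d) (Fin d) ℝ)
    (Γ : Matrix (Fin k) (Fin k) ℝ) (A : Matrix (Fin k) (Fin d) ℝ) (P : Measure Ω)
    (u : ℕ → Ω → EuclideanSpace ℝ (Fin d)) (y : ℕ → Ω → EuclideanSpace ℝ (Fin k)) : Prop where
  mean_u : VecRate P 1 (fun J ω ↦ (empMean (u · ω) J).ofLp - m₀.ofLp)
  mean_y : VecRate P 1 (fun J ω ↦ (empMean (y · ω) J).ofLp - (linMap A m₀).ofLp)
  cov_uu : MatRate P 1 (fun J ω ↦ empCov (u · ω) (u · ω) J - S₀)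
  cov_uy : MatRate P 1 (fun J ω ↦ empCov (u · ω) (y · ω) J - S₀ * Aᵀ)
  cov_yy : MatRate P 1 (fun J ω ↦ empCov (y · ω) (y · ω) J - dataCov S₀ Γ A)
  posDef_yy : ∀ᶠ J in atTop, ∀ᵐ ω ∂P, (empCov (y · ω) (y · ω) J).PosDef
  inv_yy : MatRate P 0 (fun J ω ↦ (empCov (y · ω) (y · ω) J)⁻¹)
  posDef_post : ∀ᶠ J in atTop, ∀ᵐ ω ∂P, (approxPostCov (u · ω) (y · ω) J).PosDef
  det_post : HasRate P 0 (fun J ω ↦ (approxPostCov (u · ω) (y · ω) J).det⁻¹)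

lemma goodSamples (hS₀ : S₀.PosDef) (hΓ : Γ.PosDef)
    (hlaw : ∀ j, HasLaw (fun ω ↦ (u j ω, y j ω)) (jointLaw m₀ S₀ Γ (linMap A)) P)
    (hindep : iIndepFun (fun j ω ↦ (u j ω, y j ω)) P) : GoodSamples m₀ S₀ Γ A P u y := by
  set x : ℕ → Ω → Fin d ⊕ Fin k → ℝ := fun j ω ↦ Sum.elim (u j ω).ofLp (y j ω).ofLp with hx
  have hφ : Measurable fun z : EuclideanSpace ℝ (Fin d) × EuclideanSpace ℝ (Fin k) ↦
      (Sum.elim z.1.ofLp z.2.ofLp : Fin d ⊕ Fin k → ℝ) := by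
    refine measurable_pi_lambda _ ?_
    rintro (i | i) <;> simp only [Sum.elim_inl, Sum.elim_inr] <;> fun_prop
  have hψ : Measurable fun z : EuclideanSpace ℝ (Fin d) × EuclideanSpace ℝ (Fin k) ↦ z.2.ofLp := by
    fun_prop
  have hid : ∀ j, IdentDistrib (fun ω ↦ (u j ω, y j ω)) (fun ω ↦ (u 0 ω, y 0 ω)) P P := fun j ↦
    ⟨(hlaw j).aemeasurable, (hlaw 0).aemeasurable, by rw [(hlaw j).map_eq, (hlaw 0).map_eq]⟩
  have hxind : iIndepFun x P := hindep.comp (fun _ z ↦ Sum.elim z.1.ofLp z.2.ofLp) fun _ ↦ hφ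
  have hxid : ∀ j, IdentDistrib (x j) (x 0) P P := fun j ↦ (hid j).comp hφ
  have hxg : ∀ j, IsGaussVec P (x j) (Sum.elim m₀.ofLp (linMap A m₀).ofLp) (jointCov S₀ Γ A) :=
    fun j ↦ (isGaussVec_jointLaw m₀ hS₀ hΓ A).comp (hlaw j)
  have hyg : ∀ j, IsGaussVec P (fun ω ↦ (y j ω).ofLp) (linMap A m₀).ofLp (dataCov S₀ Γ A) :=
    fun j ↦ by
      have := (isGaussVec_jointLaw_affine m₀ hS₀ hΓ A 0 (1 : Matrix (Fin k) (Fin k) ℝ) 0).comp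
        (hlaw j)
      simpa using this
  have hJ := posDef_jointCov hS₀ hΓ A
  have hmean := vecRate_avgVec_sub hxind hxid (hxg 0)
  have hcov := matRate_covMat_sub hxind hxid (hxg 0) hJ.posSemidef
  obtain ⟨hjp, hjd⟩ := posDef_covMat_and_hasRate_inv_det hxind hJ
    (fun j a ↦ (measurable_pi_apply a).comp_aemeasurable (hxid j).aemeasurable_fst) hxg
  -- Besides the joint covariance, the data block needs its own inverse moments, because the
  -- empirical gain contains its inverse.
  obtain ⟨hyp, hyd⟩ := posDef_covMat_and_hasRate_inv_det (x := fun j ω ↦ (y j ω).ofLp)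
    (hindep.comp (fun _ z ↦ z.2.ofLp) fun _ ↦ hψ) (posDef_dataCov hS₀ hΓ A)
    (fun j a ↦ (measurable_pi_apply a).comp_aemeasurable
      (hψ.comp_aemeasurable (hlaw j).aemeasurable)) hyg
  simp only [← empCov_eq_covMat] at hyp hyd
  simp only [hx, covMat_sumElim] at hcov hjp hjd
  have hyy : MatRate P 1 (fun J ω ↦ empCov (y · ω) (y · ω) J - dataCov S₀ Γ A) :=
    fun i j ↦ hcov (Sum.inr i) (Sum.inr j)
  refine ⟨fun i ↦ ?_, fun i ↦ ?_, fun i j ↦ hcov (Sum.inl i) (Sum.inl j),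
    fun i j ↦ hcov (Sum.inl i) (Sum.inr j), hyy, hyp, hyy.of_sub_const.inv hyd, ?_, ?_⟩
  · simp only [ofLp_empMean]
    exact hmean (Sum.inl i)
  · simp only [ofLp_empMean]
    exact hmean (Sum.inr i)
  · exact hjp.mono fun J h ↦ h.mono fun ω hω ↦ (posDef_schur hω).1
  · refine (hyy.of_sub_const.det.mul hjd).congr (hjp.mono fun J h ↦ h.mono fun ω hω ↦ ?_)
    exact (posDef_schur hω).2.symm

namespace GoodSamples

lemma gain (h : GoodSamples m₀ S₀ Γ A P u y) (hS₀ : S₀.PosDef) (hΓ : Γ.PosDef) :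
    MatRate P 1 (fun J ω ↦ empCov (u · ω) (y · ω) J * (empCov (y · ω) (y · ω) J)⁻¹ -
      gain S₀ Γ A) :=
  h.cov_uy.mul_sub_mul (h.cov_yy.inv_sub_inv (posDef_dataCov hS₀ hΓ A) h.inv_yy h.posDef_yy)

lemma cov_post (h : GoodSamples m₀ S₀ Γ A P u y) (hS₀ : S₀.PosDef) (hΓ : Γ.PosDef) :
    MatRate P 1 (fun J ω ↦ approxPostCov (u · ω) (y · ω) J - postCov S₀ Γ A) := by
  have h1 : MatRate P 1 (fun J ω ↦ (empCov (u · ω) (y · ω) J)ᵀ - (S₀ * Aᵀ)ᵀ) := h.cov_uy.transpose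
  have h2 := h.cov_uu.sub ((h.gain hS₀ hΓ).mul_sub_mul h1)
  refine h2.congr (Eventually.of_forall fun J ↦ Eventually.of_forall fun ω ↦ ?_)
  rw [approxPostCov, postCov]
  abel

lemma inv_post (h : GoodSamples m₀ S₀ Γ A P u y) (hS₀ : S₀.PosDef) (hΓ : Γ.PosDef) :
    MatRate P 0 (fun J ω ↦ (approxPostCov (u · ω) (y · ω) J)⁻¹) :=
  (h.cov_post hS₀ hΓ).of_sub_const.inv h.det_post

lemma mean_post (h : GoodSamples m₀ S₀ Γ A P u y) (hS₀ : S₀.PosDef) (hΓ : Γ.PosDef)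
    (y₀ : EuclideanSpace ℝ (Fin k)) :
    VecRate P 1 (fun J ω ↦
      (postMean m₀ S₀ Γ A y₀ - approxPostMean (u · ω) (y · ω) J y₀).ofLp) := by
  have h1 := (VecRate.const (P := P) (y₀ - linMap A m₀).ofLp).sub (h.mean_y.mono zero_le_one)
  have h2 := ((MatRate.const (P := P) (BOED.gain S₀ Γ A)).mulVec h.mean_y).sub
    (h.mean_u.add ((h.gain hS₀ hΓ).mulVec h1))
  intro i
  refine (h2 i).congr (Eventually.of_forall fun J ↦ Eventually.of_forall fun ω ↦ ?_)
  refine congrFun ?_ i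
  simp only [postMean, approxPostMean, WithLp.ofLp_sub, WithLp.ofLp_add, Matrix.mulVec_sub,
    Matrix.sub_mulVec]
  abel

lemma klDiv_marginal (h : GoodSamples m₀ S₀ Γ A P u y) (hS₀ : S₀.PosDef) (hΓ : Γ.PosDef) :
    HasRate P 2 (fun J ω ↦ gaussKL (dataCov S₀ Γ A) (empCov (y · ω) (y · ω) J)
      (linMap A m₀ - empMean (y · ω) J).ofLp) := by
  refine hasRate_gaussKL (posDef_dataCov hS₀ hΓ A) h.cov_yy h.inv_yy h.posDef_yy fun i ↦ ?_
  simpa using (h.mean_y i).neg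

lemma klDiv_posterior (h : GoodSamples m₀ S₀ Γ A P u y) (hS₀ : S₀.PosDef) (hΓ : Γ.PosDef)
    (y₀ : EuclideanSpace ℝ (Fin k)) :
    HasRate P 2 (fun J ω ↦ gaussKL (postCov S₀ Γ A) (approxPostCov (u · ω) (y · ω) J)
      (postMean m₀ S₀ Γ A y₀ - approxPostMean (u · ω) (y · ω) J y₀).ofLp) :=
  hasRate_gaussKL (posDef_postCov hS₀ hΓ A) (h.cov_post hS₀ hΓ) (h.inv_post hS₀ hΓ) h.posDef_post
    (h.mean_post hS₀ hΓ y₀)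

/-- The gain error occurs twice, hence rate `2`; this is the part of the lower gap due to the
variation of the data about its mean. -/
lemma trace_gain (h : GoodSamples m₀ S₀ Γ A P u y) (hS₀ : S₀.PosDef) (hΓ : Γ.PosDef) :
    HasRate P 2 (fun J ω ↦ ((approxPostCov (u · ω) (y · ω) J)⁻¹ *
      ((BOED.gain S₀ Γ A - empCov (u · ω) (y · ω) J * (empCov (y · ω) (y · ω) J)⁻¹) *
        dataCov S₀ Γ A * (BOED.gain S₀ Γ A -
          empCov (u · ω) (y · ω) J * (empCov (y · ω) (y · ω) J)⁻¹)ᵀ)).trace) := by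
  have hg := (h.gain hS₀ hΓ).neg
  simp only [neg_sub] at hg
  exact ((h.inv_post hS₀ hΓ).mul ((hg.mul (MatRate.const _)).mul hg.transpose)).trace

end GoodSamples

/-- Data equal to their mean leave the prior mean unchanged. Hence the divergence in
`lower_bound_eq` is the one between posteriors at this data value, and `GoodSamples.klDiv_posterior`
applies to it. -/
lemma postMean_linMap : postMean m₀ S₀ Γ A (linMap A m₀) = m₀ := by
  simp [postMean]

lemma ofLp_approxPostMean (u : ℕ → EuclideanSpace ℝ (Fin d)) (y : ℕ → EuclideanSpace ℝ (Fin k))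
    (J : ℕ) (y₀ : EuclideanSpace ℝ (Fin k)) : (approxPostMean u y J y₀).ofLp =
      (empCov u y J * (empCov y y J)⁻¹) *ᵥ y₀.ofLp + ((empMean u J).ofLp -
        (empCov u y J * (empCov y y J)⁻¹) *ᵥ (empMean y J).ofLp) := by
  simp only [approxPostMean, WithLp.ofLp_add, WithLp.ofLp_sub, Matrix.mulVec_sub]
  abel

end Approximation

end BOED

/-! ### Assembly of the closed forms and the rates. -/

theorem mainTheorem2 {d k : ℕ} {𝒟 : Type*}
    (m₀ : EuclideanSpace ℝ (Fin d)) (S₀ : Matrix (Fin d) (Fin d) ℝ) (hS₀ : S₀.PosDef)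
    (Γ : Matrix (Fin k) (Fin k) ℝ) (hΓ : Γ.PosDef)
    (G : EuclideanSpace ℝ (Fin d) → 𝒟 → EuclideanSpace ℝ (Fin k))
    (A : 𝒟 → Matrix (Fin k) (Fin d) ℝ)
    (hG : ∀ u p, G u p = WithLp.toLp 2 (A p *ᵥ u.ofLp))
    (p : 𝒟)
    {Ω : Type*} [MeasurableSpace Ω] (P : Measure Ω) [IsProbabilityMeasure P]
    (u : ℕ → Ω → EuclideanSpace ℝ (Fin d)) (y : ℕ → Ω → EuclideanSpace ℝ (Fin k))
    (hlaw : ∀ j, HasLaw (fun ω ↦ (u j ω, y j ω)) (BOED.jointLaw m₀ S₀ Γ (G · p)) P)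
    (hindep : iIndepFun (fun j ω ↦ (u j ω, y j ω)) P) :
    -- the Gaussian approximation of the marginal of the data
    BOED.TendstoZeroL2WithRate P
      (fun J ω ↦ klDiv (BOED.marginalLaw m₀ S₀ Γ (G · p)) (BOED.approxMarginal (y · ω) J))
      (fun J ↦ (J : ℝ)⁻¹) ∧
    -- the Gaussian approximation of the posterior, for every data value
    (∀ y₀ : EuclideanSpace ℝ (Fin k),
      BOED.TendstoZeroL2WithRate P
        (fun J ω ↦ klDiv (BOED.posteriorLaw m₀ S₀ Γ (G · p) y₀)
          (BOED.approxPosterior (u · ω) (y · ω) J y₀))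
        (fun J ↦ (J : ℝ)⁻¹)) ∧
    -- the bounds on the expected information gain hold almost surely and become tight
    BOED.EIG m₀ S₀ Γ (G · p) ≠ ∞ ∧
    (∀ᶠ J in atTop, ∀ᵐ ω ∂P,
      Integrable (BOED.upperIntegrand (y · ω) J Γ (G · p)) (BOED.jointLaw m₀ S₀ Γ (G · p)) ∧
      Integrable (BOED.lowerIntegrand (u · ω) (y · ω) J m₀ S₀)
        (BOED.jointLaw m₀ S₀ Γ (G · p)) ∧
      BOED.eigLower (u · ω) (y · ω) J m₀ S₀ Γ (G · p) ≤ (BOED.EIG m₀ S₀ Γ (G · p)).toReal ∧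
      (BOED.EIG m₀ S₀ Γ (G · p)).toReal ≤ BOED.eigUpper (y · ω) J m₀ S₀ Γ (G · p)) ∧
    BOED.TendstoZeroL2WithRate P
      (fun J ω ↦ BOED.eigUpper (y · ω) J m₀ S₀ Γ (G · p) - (BOED.EIG m₀ S₀ Γ (G · p)).toReal)
      (fun J ↦ (J : ℝ)⁻¹) ∧
    BOED.TendstoZeroL2WithRate P
      (fun J ω ↦ (BOED.EIG m₀ S₀ Γ (G · p)).toReal -
        BOED.eigLower (u · ω) (y · ω) J m₀ S₀ Γ (G · p))
      (fun J ↦ (J : ℝ)⁻¹) := by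
  have hGp : (G · p) = BOED.linMap (A p) := funext fun v ↦ hG v p
  rw [hGp] at hlaw ⊢
  have hs := BOED.goodSamples hS₀ hΓ hlaw hindep
  have hup := fun J ω (h : (BOED.empCov (y · ω) (y · ω) J).PosDef) ↦
    BOED.upper_bound_eq m₀ hS₀ hΓ (A p) h (BOED.empMean (y · ω) J)
  have hlo := fun J ω (h : (BOED.approxPostCov (u · ω) (y · ω) J).PosDef) ↦
    BOED.lower_bound_eq m₀ hS₀ hΓ (A p) h
      (BOED.empCov (u · ω) (y · ω) J * (BOED.empCov (y · ω) (y · ω) J)⁻¹)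
      (BOED.ofLp_approxPostMean (u · ω) (y · ω) J)
  refine ⟨?_, fun y₀ ↦ ?_, ?_, ?_, ?_, ?_⟩
  · refine BOED.tendstoZeroL2_klDiv (hs.klDiv_marginal hS₀ hΓ) ?_
    filter_upwards [hs.posDef_yy] with J hJ
    filter_upwards [hJ] with ω hω
    rw [BOED.marginalLaw_eq m₀ hS₀ hΓ, BOED.approxMarginal,
      (BOED.klDiv_multivariateGaussian _ _ (BOED.posDef_dataCov hS₀ hΓ (A p)) hω).1]
  · refine BOED.tendstoZeroL2_klDiv (hs.klDiv_posterior hS₀ hΓ y₀) ?_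
    filter_upwards [hs.posDef_post] with J hJ
    filter_upwards [hJ] with ω hω
    rw [BOED.posteriorLaw_eq m₀ hS₀ hΓ, BOED.approxPosterior,
      (BOED.klDiv_multivariateGaussian _ _ (BOED.posDef_postCov hS₀ hΓ (A p)) hω).1]
  · rw [(BOED.EIG_eq m₀ hS₀ hΓ (A p)).1]
    exact ENNReal.ofReal_ne_top
  · filter_upwards [hs.posDef_yy, hs.posDef_post] with J h1 h2
    filter_upwards [h1, h2] with ω h3 h4
    refine ⟨(hup J ω h3).1, (hlo J ω h4).1, ?_, ?_⟩
    -- The gap of the lower bound is a divergence plus half the trace of a product of positive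
    -- semidefinite matrices.
    · rw [← sub_nonneg, BOED.eigLower]
      refine le_of_le_of_eq ?_ (hlo J ω h4).2.symm
      have := BOED.trace_mul_conj_nonneg h4.inv.posSemidef
        (BOED.posDef_dataCov hS₀ hΓ (A p)).posSemidef (BOED.gain S₀ Γ (A p) -
          BOED.empCov (u · ω) (y · ω) J * (BOED.empCov (y · ω) (y · ω) J)⁻¹)
      exact add_nonneg (BOED.gaussKL_nonneg (BOED.posDef_postCov hS₀ hΓ (A p)) h4 _)
        (mul_nonneg (by norm_num) this)
    · rw [BOED.eigUpper]
      refine le_of_le_of_eq ?_ (hup J ω h3).2.symm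
      exact le_add_of_nonneg_right
        (BOED.gaussKL_nonneg (BOED.posDef_dataCov hS₀ hΓ (A p)) h3 _)
  · refine BOED.tendstoZeroL2_of_ae_eq (hs.klDiv_marginal hS₀ hΓ) ?_
    filter_upwards [hs.posDef_yy] with J hJ
    filter_upwards [hJ] with ω hω
    rw [sub_eq_iff_eq_add']
    exact (hup J ω hω).2
  -- The two parts of the lower gap, at the data mean and in the gain, each have rate `2`.
  · have hr := hs.klDiv_posterior hS₀ hΓ (BOED.linMap (A p) m₀)
    simp only [BOED.postMean_linMap] at hr
    refine BOED.tendstoZeroL2_of_ae_eq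
      (hr.add ((hs.trace_gain hS₀ hΓ).const_mul (1 / 2))) ?_
    filter_upwards [hs.posDef_post] with J hJ
    filter_upwards [hJ] with ω hω
    exact (hlo J ω hω).2
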